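/- \textbf{Setting.} Let $n\ge 2$ and let $\mathcal T$ be a vector addition system (VAS) of dimension $n$, i.e. a finite nonempty set $\mathcal T\subseteq\mathbb Z^n$ of transitions. Put $\|\mathcal T\|=\max\{|b(i)| : b\in\mathcal T,\ 1\le i\le n\}$ and $\|\mathcal T\|^-=\max\{\max(0,-b(i)) : b\in\mathcal T,\ 1\le i\le n\}$, and assume $\|\mathcal T\|^-\ge 1$. A \emph{pseudo-run} is given by an initial vector $u_0\in\mathbb Z^n$ and a finite sequence $t_1,\dots,t_k\in\mathcal T$ ($k\ge 0$); it is the sequence $u_0,\dots,u_k$ in $\mathbb Z^n$ with $u_i=u_{i-1}+t_i$, and its length is $k+1$. A \emph{generalized unboundedness property} of length $K\ge 1$ is a sequence $\mathcal P=(\mathcal I_1,\dots,\mathcal I_K)$ of $n$-tuples of intervals of $\mathbb Z$, each of the form $]-\infty,+\infty[$, $[a,+\infty[$, $]-\infty,b]$ or $[a,b]$ with $a,b\in\mathbb Z$. Its scale $\|\mathcal P\|$ is the maximum of $1$ and of the absolute values of the integers occurring in these interval expressions. A pseudo-run $u_0,\dots,u_k$ \emph{weakly satisfies} $\mathcal P$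 if there are positions $0=f(0)\le f(1)\le\dots\le f(2K)=k$ such that, with $x_i=u_{f(i)}$: (P1) $x_{2l}(j)-x_{2l-1}(j)\in\mathcal I_l(j)$ for all $1\le l\le K$ and $1\le j\le n$; (P2) for all $1\le l\le K$ and $1\le j\le n$, if $x_{2l}(j)-x_{2l-1}(j)<0$, then $x_{2l'}(j)-x_{2l'-1}(j)>0$ for some $1\le l'<l$; (P3) for all $1\le j\le n$ and $0\le i\le k$, if $u_i(j)<0$, then there is $1\le l\le K$ with $f(2l)<i$ and $x_{2l}(j)-x_{2l-1}(j)>0$. \textbf{Lemma.} There is a constant $C>1$, independent of $n$, $\mathcal T$, $K$, $\mathcal P$ and the pseudo-run, such that the following holds. If a pseudo-run of $\mathcal T$ weakly satisfies a generalized unboundedness property $\mathcal P$ of length $K$, then there is a pseudo-run of $\mathcal T$ starting from the same vector, weakly satisfying $\mathcal P$, and of length at most $$\bigl(2\,\mu\,\|\mathcal T\|^-\bigr)^{\,n^{(2n+1)C}},\qquad \mu=(1+K)\cdot\|\mathcal T\|\cdot\|\mathcal P\|.$$ -/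

import Mathlib

namespace GenUnbound

/-- Interval expressions over the integers: `]-∞,+∞[`, `[a,+∞[`, `]-∞,b]` and `[a,b]`. -/
inductive Interval : Type where
  | all : Interval
  | ge (a : ℤ) : Interval
  | le (b : ℤ) : Interval
  | between (a b : ℤ) : Interval

namespace Interval

/-- The set of integers denoted by an interval expression. -/
def toSet : Interval → Set ℤ
  | all => Set.univ
  | ge a => Set.Ici a
  | le b => Set.Iic b
  | between a b => Set.Icc a b

/-- The maximal absolute value of an integer occurring in the expression (`0` if none occurs). -/
def absMax : Interval → ℕ
  | all => 0
  | ge a => a.natAbs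
  | le b => b.natAbs
  | between a b => max a.natAbs b.natAbs

end Interval

/-- A generalized unboundedness property of dimension `n` and length `K`: a sequence of `K`
tuples of intervals (the length of a property is required to be positive where it is used).
The sequence is indexed from `0`, so `P l` is the `(l+1)`-st tuple. -/
abbrev Property (n K : ℕ) : Type := Fin K → Fin n → Interval

/-- The scale of a property: the maximum of `1` and of the absolute values of all integers
occurring in its interval expressions. -/
def Property.scale {n K : ℕ} (P : Property n K) : ℕ :=
  max 1 (Finset.univ.sup fun l => Finset.univ.sup fun j => (P l j).absMax)

/-- `‖T‖`: the maximal absolute value of a component of a transition of the VAS `T`. -/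
def absNorm {n : ℕ} (T : Finset (Fin n → ℤ)) : ℕ :=
  T.sup fun b => Finset.univ.sup fun i => (b i).natAbs

/-- `‖T‖⁻`: the maximum of all `max (0, -b(i))` for a transition `b` of the VAS `T`. -/
def negNorm {n : ℕ} (T : Finset (Fin n → ℤ)) : ℕ :=
  T.sup fun b => Finset.univ.sup fun i => (-(b i)).toNat

/-- A (finite) pseudo-run of the VAS `T`, given by an initial pseudo-configuration in `ℤⁿ` and a
path, i.e. a finite sequence of transitions of `T`. -/
structure PseudoRun {n : ℕ} (T : Finset (Fin n → ℤ)) : Type where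
  start : Fin n → ℤ
  path : List (Fin n → ℤ)
  path_mem : ∀ t ∈ path, t ∈ T

namespace PseudoRun

variable {n : ℕ} {T : Finset (Fin n → ℤ)}

/-- The pseudo-configuration `u_i` (for `i ≤ ρ.path.length`) of the pseudo-run. -/
def config (ρ : PseudoRun T) (i : ℕ) : Fin n → ℤ :=
  ρ.start + (ρ.path.take i).sum

/-- The length of a pseudo-run is its number of pseudo-configurations. -/
def length (ρ : PseudoRun T) : ℕ := ρ.path.length + 1

/-- `f` describes a decomposition
`x_0 →[π'_0] x_1 →[π_1] x_2 →[π'_1] x_3 ⋯ →[π'_{K-1}] x_{2K-1} →[π_K] x_{2K}`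
of the pseudo-run: `x_i` is its pseudo-configuration at position `f i`, for `0 ≤ i ≤ 2K`.
Only the values `f 0, …, f (2 * K)` matter. -/
def IsDecomposition (ρ : PseudoRun T) (K : ℕ) (f : ℕ → ℕ) : Prop :=
  f 0 = 0 ∧ f (2 * K) = ρ.path.length ∧ ∀ i < 2 * K, f i ≤ f (i + 1)

/-- The effect `x_{2l+2} - x_{2l+1}` of the path `π_{l+1}`, for `0 ≤ l < K`. -/
def effect (ρ : PseudoRun T) (f : ℕ → ℕ) (l : ℕ) : Fin n → ℤ :=
  ρ.config (f (2 * l + 2)) - ρ.config (f (2 * l + 1))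

/-- The pseudo-run weakly satisfies `P`: some decomposition satisfies (P1), (P2) and (P3).
(A VAS has a single control state, so there is no condition on control states.) -/
def WeaklySatisfies {K : ℕ} (ρ : PseudoRun T) (P : Property n K) : Prop :=
  ∃ f : ℕ → ℕ, ρ.IsDecomposition K f ∧
    (∀ (l : Fin K) (j : Fin n), ρ.effect f l j ∈ (P l j).toSet) ∧
    (∀ (l : Fin K) (j : Fin n), ρ.effect f l j < 0 → ∃ l' : Fin K, l' < l ∧ 0 < ρ.effect f l' j) ∧
    (∀ (j : Fin n) (i : ℕ), i ≤ ρ.path.length → ρ.config i j < 0 →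
      ∃ l : Fin K, f (2 * l + 2) < i ∧ 0 < ρ.effect f l j)

end PseudoRun

end GenUnbound

/-! The proof is a Rackoff induction. Cut the run at x_0, x_2, ..., x_{2K} into K segments, each a
free part followed by a part whose effect is constrained. Let A_l be the set of coordinates that no
constrained part before segment l has increased. By (P3) the coordinates in A_l are nonnegative
along segment l, and by (P2) the constrained effect there is nonnegative on A_l. Conversely, any
path through segments with these sets A_l, and with effects in the same intervals and of the same
signs, weakly satisfies the property. So it suffices to bound solutions of lists of segments (`Sol`,
`WellFormed`), where the sets A_l decrease; `PseudoRun.WeaklySatisfies.exists_short` makes this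
reduction.

The induction is on the number of coordinates that must be nonnegative (`ShortSolutions.succ`).
Suppose solutions of length at most L exist when there are fewer such coordinates, and let d bound
the decrease of a coordinate in one transition. If a segment keeps all coordinates of A_l below dL,
then its projection to A_l is a walk in a finite graph. The walk is a short skeleton plus short
loops; only the multiplicities of the loop effects matter, and they solve a linear system over the
naturals, so a small solution gives a short walk with the same effect on A_l and a permitted effect
elsewhere (`exists_short_walk`, `exists_small_solution`). If some coordinate reaches dL, shorten the
path up to that point, forget the coordinate and apply the induction hypothesis: in L transitions
the coordinate loses at most dL, so it stays nonnegative. When this point lies inside a constrained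
part, that part is first replaced by a cyclic rotation (`Sol.rotate`).

One induction step multiplies the exponent of the bound by n^8 (`walkBound_step_le`), which yields
the doubly exponential bound. -/

namespace GenUnbound

/-! ### Small solutions of integer linear systems -/

section Linear

attribute [local instance] Matrix.seminormedAddCommGroup

/-- Siegel's lemma in natural-number form, including the case without equations. -/
lemma exists_small_kernel_of_card_lt {α ι : Type*} [Fintype α] [Fintype ι]
    (A : Matrix α ι ℤ) (N : ℕ) (hN : 1 ≤ N) (hA : ∀ a i, (A a i).natAbs ≤ N)
    (hlt : Fintype.card α < Fintype.card ι) :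
    ∃ y : ι → ℤ, y ≠ 0 ∧ A.mulVec y = 0 ∧
      ∀ i, (y i).natAbs ≤ (Fintype.card ι * N) ^ Fintype.card α := by
  classical
  have hι : 1 ≤ Fintype.card ι := by omega
  rcases Nat.eq_zero_or_pos (Fintype.card α) with h0 | hpos
  · have : IsEmpty α := Fintype.card_eq_zero_iff.mp h0
    obtain ⟨i⟩ : Nonempty ι := Fintype.card_pos_iff.mp hι
    refine ⟨Pi.single i 1, fun h => ?_, Subsingleton.elim _ _, fun k => ?_⟩
    · simpa using congrFun h i
    · rw [h0, pow_zero]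
      by_cases hk : k = i
      · subst hk; simp
      · simp [hk]
  · obtain ⟨t, ht0, htA, htn⟩ := Int.Matrix.exists_ne_zero_int_vec_norm_le A hlt hpos
    refine ⟨t, ht0, htA, fun i => ?_⟩
    have hAn : ‖A‖ ≤ (N : ℝ) := by
      rw [Matrix.norm_le_iff (by positivity)]
      intro a b
      rw [Int.norm_eq_abs, ← Int.cast_abs, Int.abs_eq_natAbs]
      exact_mod_cast hA a b
    have hN' : (1 : ℝ) ≤ N := by exact_mod_cast hN
    have hι' : (1 : ℝ) ≤ Fintype.card ι := by exact_mod_cast hι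
    have hbase : (Fintype.card ι : ℝ) * max 1 ‖A‖ ≤ (Fintype.card ι * N : ℕ) := by
      push_cast
      gcongr
      exact max_le hN' hAn
    have hbase1 : (1 : ℝ) ≤ (Fintype.card ι : ℝ) * max 1 ‖A‖ :=
      one_le_mul_of_one_le_of_one_le hι' (le_max_left _ _)
    -- With m equations in k unknowns, Siegel's exponent m/(k-m) is at most m because k-m ≥ 1.
    have hexp : (Fintype.card α : ℝ) / (Fintype.card ι - Fintype.card α) ≤ Fintype.card α := by
      apply div_le_self (by positivity)
      have : (Fintype.card α : ℝ) + 1 ≤ Fintype.card ι := by exact_mod_cast hlt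
      linarith
    have h1 : ‖t i‖ ≤ ((Fintype.card ι * N : ℕ) : ℝ) ^ Fintype.card α := by
      calc ‖t i‖ ≤ ‖t‖ := norm_le_pi_norm t i
        _ ≤ _ := htn
        _ ≤ ((Fintype.card ι : ℝ) * max 1 ‖A‖) ^ (Fintype.card α : ℝ) :=
            Real.rpow_le_rpow_of_exponent_le hbase1 hexp
        _ = ((Fintype.card ι : ℝ) * max 1 ‖A‖) ^ Fintype.card α := Real.rpow_natCast _ _
        _ ≤ _ := by gcongr
    rw [Int.norm_eq_abs, ← Int.cast_abs, Int.abs_eq_natAbs] at h1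
    exact_mod_cast h1

end Linear

/-- A homogeneous integer system with a nonzero solution has a small nonzero solution. -/
lemma exists_small_kernel {α ι : Type*} [Fintype α] [Fintype ι]
    (A : Matrix α ι ℤ) (N : ℕ) (hN : 1 ≤ N) (hA : ∀ a i, (A a i).natAbs ≤ N)
    (x : ι → ℤ) (hx : x ≠ 0) (hAx : A.mulVec x = 0) :
    ∃ y : ι → ℤ, y ≠ 0 ∧ A.mulVec y = 0 ∧
      ∀ i, (y i).natAbs ≤ (Fintype.card ι * N) ^ Fintype.card α := by
  classical
  have hι : 1 ≤ Fintype.card ι := by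
    obtain ⟨i, -⟩ := Function.ne_iff.mp hx
    exact Fintype.card_pos_iff.mpr ⟨i⟩
  let v : α → ι → ℚ := fun a i => (A a i : ℚ)
  have key : ∀ (z : ι → ℤ) (a : α), A.mulVec z a = 0 ↔ ∑ i, v a i * (z i : ℚ) = 0 := by
    intro z a
    simp only [Matrix.mulVec, dotProduct, v]
    exact_mod_cast Iff.rfl
  have spanz : ∀ (z : ι → ℤ) (s : Set (ι → ℚ)), (∀ w ∈ s, ∑ i, w i * (z i : ℚ) = 0) →
      ∀ w ∈ Submodule.span ℚ s, ∑ i, w i * (z i : ℚ) = 0 := by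
    intro z s hs w hw
    induction hw using Submodule.span_induction with
    | mem w hw => exact hs w hw
    | zero => simp
    | add u w _ _ hu hw => simp [add_mul, Finset.sum_add_distrib, hu, hw]
    | smul c w _ hw =>
      have : ∑ i, (c • w) i * (z i : ℚ) = c * ∑ i, w i * (z i : ℚ) := by
        rw [Finset.mul_sum]; simp [mul_assoc]
      rw [this, hw, mul_zero]
  -- Keep only a basis of the row space over ℚ: the kernel is unchanged, and the existence of `x`
  -- forces fewer rows than unknowns, so Siegel's lemma applies.
  obtain ⟨κ, g, hg, hspan, hind⟩ := exists_linearIndependent' ℚ v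
  have : Fintype κ := Fintype.ofInjective g hg
  have hκα : Fintype.card κ ≤ Fintype.card α := Fintype.card_le_of_injective g hg
  have hlt : Fintype.card κ < Fintype.card ι := by
    have hle : Fintype.card κ ≤ Fintype.card ι := by
      simpa using hind.fintype_card_le_finrank
    refine lt_of_le_of_ne hle fun heq => ?_
    -- If the rows spanned everything, `x` would be orthogonal to itself.
    have htop := hind.span_eq_top_of_card_eq_finrank' (by simpa using heq)
    have hz := spanz x (Set.range (v ∘ g)) (by
      rintro _ ⟨k, rfl⟩
      exact (key x (g k)).mp (congrFun hAx _)) (fun i => (x i : ℚ)) (by rw [htop]; trivial)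
    apply hx
    ext i
    have := (Finset.sum_eq_zero_iff_of_nonneg (fun i _ => mul_self_nonneg (x i : ℚ))).mp hz i
      (Finset.mem_univ i)
    simpa using this
  obtain ⟨y, hy0, hyA, hyb⟩ := exists_small_kernel_of_card_lt (A.submatrix g id) N hN
    (fun a i => hA _ _) hlt
  refine ⟨y, hy0, ?_, fun i => (hyb i).trans ?_⟩
  · ext a
    rw [Pi.zero_apply, key]
    refine spanz y (Set.range (v ∘ g)) ?_ (v a) ?_
    · rintro _ ⟨k, rfl⟩
      exact (key y (g k)).mp (congrFun hyA k)
    · rw [hspan]; exact Submodule.subset_span ⟨a, rfl⟩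
  · exact Nat.pow_le_pow_right (Nat.mul_pos hι hN) hκα

end GenUnbound

namespace GenUnbound

/-- Extension by zero of an integer vector indexed by a finset. -/
def zeroExtend {ι : Type*} [DecidableEq ι] (S : Finset ι) (y : S → ℤ) : ι → ℤ :=
  fun i => if h : i ∈ S then y ⟨i, h⟩ else 0

lemma mulVec_zeroExtend {α ι : Type*} [Fintype ι] [DecidableEq ι]
    (A : Matrix α ι ℤ) (S : Finset ι) (y : S → ℤ) :
    A.mulVec (zeroExtend S y) = (A.submatrix id (fun i : S => (i : ι))).mulVec y := by
  ext a
  simp only [Matrix.mulVec, dotProduct, Matrix.submatrix_apply, id]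
  rw [← Finset.sum_subset (Finset.subset_univ S), ← Finset.sum_coe_sort S]
  · refine Finset.sum_congr rfl fun i _ => ?_
    simp [zeroExtend]
  · intro i _ hi
    simp [zeroExtend, hi]

lemma zeroExtend_ne_zero {ι : Type*} [DecidableEq ι] {S : Finset ι} {y : S → ℤ} (hy : y ≠ 0) :
    zeroExtend S y ≠ 0 := by
  obtain ⟨i, hi⟩ := Function.ne_iff.mp hy
  refine Function.ne_iff.mpr ⟨i, ?_⟩
  simpa [zeroExtend] using hi

/-- Every nonnegative integer solution of a linear system can be replaced by one that dominates
no nonzero element of the kernel in absolute value. -/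
lemma exists_solution_not_dominating_kernel {α ι : Type*} [Fintype ι]
    (A : Matrix α ι ℤ) (x : ι → ℕ) :
    ∃ z : ι → ℕ, A.mulVec (fun i => (z i : ℤ)) = A.mulVec (fun i => (x i : ℤ)) ∧
      ∀ y : ι → ℤ, A.mulVec y = 0 → (∀ i, (y i).natAbs ≤ z i) → y = 0 := by
  classical
  -- Choose z with least sum and, among those, largest sum of squares. If y is in the kernel and |y|
  -- ≤ z, then z + y and z - y are again solutions. Minimality of the sum gives ∑ y = 0, and then |z
  -- + y|² + |z - y|² = 2|z|² + 2|y|² forces y = 0.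
  let f : (ι → ℕ) → ℕ ×ₗ ℕ := fun z => toLex (∑ i, z i, (∑ i, z i) ^ 2 - ∑ i, z i ^ 2)
  obtain ⟨z, hz, hmin⟩ := (InvImage.wf f wellFounded_lt).has_min
    {z | A.mulVec (fun i => (z i : ℤ)) = A.mulVec (fun i => (x i : ℤ))} ⟨x, rfl⟩
  refine ⟨z, hz, fun y hy hyz => ?_⟩
  have hsq : ∀ w : ι → ℕ, ∑ i, w i ^ 2 ≤ (∑ i, w i) ^ 2 := fun w =>
    Finset.sum_sq_le_sq_sum_of_nonneg fun i _ => Nat.zero_le _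
  have step : ∀ u : ι → ℤ, A.mulVec u = 0 → (∀ i, (u i).natAbs ≤ z i) →
      0 ≤ ∑ i, u i ∧ (∑ i, u i = 0 → ∑ i, (2 * (z i : ℤ) * u i + u i ^ 2) ≤ 0) := by
    intro u hu huz
    let w : ι → ℕ := fun i => (z i + u i).toNat
    have hw : ∀ i, (w i : ℤ) = z i + u i := fun i => by
      have := huz i
      simp only [w]
      omega
    have hwS : A.mulVec (fun i => (w i : ℤ)) = A.mulVec (fun i => (x i : ℤ)) := by
      have : (fun i => (w i : ℤ)) = (fun i => (z i : ℤ)) + u := funext hw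
      rw [this, Matrix.mulVec_add, hu, add_zero]
      exact hz
    have hnot := hmin w hwS
    simp only [InvImage, f, Prod.Lex.toLex_lt_toLex, not_or, not_and, not_lt] at hnot
    have hsum : (∑ i, (w i : ℤ)) = ∑ i, (z i : ℤ) + ∑ i, u i := by
      rw [← Finset.sum_add_distrib]; exact Finset.sum_congr rfl fun i _ => hw i
    have h1 : (∑ i, (z i : ℤ)) ≤ ∑ i, (w i : ℤ) := by exact_mod_cast hnot.1
    refine ⟨by linarith, fun h0 => ?_⟩
    have heq : ∑ i, w i = ∑ i, z i := by
      have : (∑ i, (w i : ℤ)) = ∑ i, (z i : ℤ) := by rw [hsum, h0, add_zero]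
      exact_mod_cast this
    have h2 := hnot.2 heq
    rw [heq] at h2
    have h3 := hsq z
    have h4 := hsq w
    rw [heq] at h4
    have h5 : ∑ i, w i ^ 2 ≤ ∑ i, z i ^ 2 := by omega
    have h6 : (∑ i, (w i : ℤ) ^ 2) ≤ ∑ i, (z i : ℤ) ^ 2 := by exact_mod_cast h5
    have h7 : (∑ i, (w i : ℤ) ^ 2) =
        ∑ i, (z i : ℤ) ^ 2 + ∑ i, (2 * (z i : ℤ) * u i + u i ^ 2) := by
      rw [← Finset.sum_add_distrib]
      exact Finset.sum_congr rfl fun i _ => by rw [hw i]; ring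
    linarith
  obtain ⟨p1, p2⟩ := step y hy hyz
  obtain ⟨m1, m2⟩ := step (-y) (by rw [Matrix.mulVec_neg, hy, neg_zero]) (fun i => by simpa using hyz i)
  simp only [Pi.neg_apply, Finset.sum_neg_distrib] at m1 m2
  have h0 : ∑ i, y i = 0 := by linarith
  have hp := p2 h0
  have hm := m2 (by rw [h0, neg_zero])
  have hs : ∑ i, y i ^ 2 ≤ 0 := by
    have : 2 * ∑ i, y i ^ 2 = ∑ i, (2 * (z i : ℤ) * y i + y i ^ 2) +
        ∑ i, (2 * (z i : ℤ) * -y i + (-y i) ^ 2) := by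
      rw [← Finset.sum_add_distrib, Finset.mul_sum]
      exact Finset.sum_congr rfl fun i _ => by ring
    linarith
  have hs0 := le_antisymm hs (Finset.sum_nonneg fun i _ => sq_nonneg _)
  ext i
  have := (Finset.sum_eq_zero_iff_of_nonneg (fun i _ => sq_nonneg (y i))).mp hs0 i
    (Finset.mem_univ i)
  simpa using this

/-- Small solutions of integer linear systems over the natural numbers. -/
lemma exists_small_solution {ι : Type*} [Fintype ι] {n : ℕ}
    (A : Matrix (Fin n) ι ℤ) (N R : ℕ) (hN : 1 ≤ N) (hA : ∀ a i, (A a i).natAbs ≤ N)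
    (x : ι → ℕ) (hR : ∀ a, (A.mulVec (fun i => (x i : ℤ)) a).natAbs ≤ R) :
    ∃ z : ι → ℕ, A.mulVec (fun i => (z i : ℤ)) = A.mulVec (fun i => (x i : ℤ)) ∧
      ∀ i, z i ≤ ((n + 1) * (R + Fintype.card ι * ((n + 1) * N) ^ n * N + N)) ^ n := by
  classical
  obtain ⟨z, hz, hker⟩ := exists_solution_not_dominating_kernel A x
  refine ⟨z, hz, ?_⟩
  set b := ((n + 1) * N) ^ n with hb
  set N' := R + Fintype.card ι * b * N + N with hN'
  -- A kernel vector supported on the large coordinates `S` with entries at most `b` would be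
  -- dominated by `z`, so it vanishes. As `b` is a Siegel bound for up to n+1 columns, the columns
  -- in `S` are linearly independent and at most n in number.
  let S : Finset ι := Finset.univ.filter fun i => b < z i
  have small : ∀ S' ⊆ S, ∀ y : S' → ℤ, (A.submatrix id (fun i : S' => (i : ι))).mulVec y = 0 →
      (∀ i, (y i).natAbs ≤ b) → y = 0 := by
    intro S' hS' y hy hyb
    by_contra hne
    refine zeroExtend_ne_zero hne (hker _ (by rw [mulVec_zeroExtend, hy]) fun i => ?_)
    by_cases hi : i ∈ S'
    · have h1 : b < z i := (Finset.mem_filter.mp (hS' hi)).2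
      simpa [zeroExtend, hi] using (hyb ⟨i, hi⟩).trans h1.le
    · simp [zeroExtend, hi]
  have hcard : S.card ≤ n := by
    by_contra hlt
    push Not at hlt
    obtain ⟨S', hS', hc⟩ := Finset.exists_subset_card_eq (s := S) (n := n + 1) hlt
    obtain ⟨y, hy0, hyA, hyb⟩ := exists_small_kernel_of_card_lt
      (A.submatrix id (fun i : S' => (i : ι))) N hN (fun a i => hA _ _) (by simp [hc])
    exact hy0 (small S' hS' y hyA (by simpa [hc] using hyb))
  have indep : ∀ y : S → ℤ, (A.submatrix id (fun i : S => (i : ι))).mulVec y = 0 → y = 0 := by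
    intro y hy
    by_contra hne
    obtain ⟨y', hy0, hyA, hyb⟩ := exists_small_kernel
      (A.submatrix id (fun i : S => (i : ι))) N hN (fun a i => hA _ _) y hne hy
    refine hy0 (small S subset_rfl y' hyA fun i => (hyb i).trans ?_)
    simp only [Fintype.card_coe, Fintype.card_fin, hb]
    gcongr
    omega
  have hbX : b ≤ ((n + 1) * N') ^ n := by
    rw [hb]; gcongr; omega
  intro i
  by_cases hi : i ∈ S
  swap
  · refine le_trans ?_ hbX
    simpa [S] using hi
  let zS : S → ℤ := fun i => (z i : ℤ)
  let r : Fin n → ℤ := (A.submatrix id (fun i : S => (i : ι))).mulVec zS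
  have hr : ∀ a, (r a).natAbs ≤ N' := by
    intro a
    have h1 : A.mulVec (fun i => (z i : ℤ)) a =
        r a + ∑ i ∈ Finset.univ \ S, A a i * (z i : ℤ) := by
      simp only [r, zS, Matrix.mulVec, dotProduct, Matrix.submatrix_apply, id]
      rw [Finset.sum_coe_sort S (fun i => A a i * (z i : ℤ)), add_comm,
        Finset.sum_sdiff (Finset.subset_univ S)]
    have h2 : |∑ i ∈ Finset.univ \ S, A a i * (z i : ℤ)| ≤ Fintype.card ι * b * N := by
      calc _ ≤ ∑ i ∈ Finset.univ \ S, |A a i * (z i : ℤ)| := Finset.abs_sum_le_sum_abs _ _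
        _ ≤ ∑ i ∈ Finset.univ \ S, (N * b : ℤ) := by
          refine Finset.sum_le_sum fun i hi => ?_
          have h3 : z i ≤ b := by simpa [S] using hi
          rw [abs_mul, Int.abs_eq_natAbs, Nat.abs_cast]
          have := hA a i
          gcongr
        _ ≤ ∑ _i : ι, (N * b : ℤ) :=
          Finset.sum_le_sum_of_subset_of_nonneg Finset.sdiff_subset fun _ _ _ => by positivity
        _ = _ := by simp; ring
    have h4 := hR a
    rw [← hz, h1] at h4
    generalize (∑ i ∈ Finset.univ \ S, A a i * (z i : ℤ)) = t at h2 h4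
    have h5 : t.natAbs ≤ Fintype.card ι * b * N := by
      zify; exact h2
    omega
  -- A substitute for Cramer's rule: append the right-hand side `r` as a column. The kernel contains
  -- (-1, z_S), hence a small nonzero vector y; independence of the other columns makes y_none
  -- nonzero, and y_none * z_i = -y_i bounds z_i.
  let A' : Matrix (Fin n) (Option S) ℤ := fun a o => o.elim (r a) fun i => A a i
  have mulA' : ∀ (y : Option S → ℤ) a, A'.mulVec y a =
      r a * y none + (A.submatrix id (fun i : S => (i : ι))).mulVec (fun i => y (some i)) a := by
    intro y a
    simp [A', Matrix.mulVec, dotProduct, Fintype.sum_option]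
  obtain ⟨y, hy0, hyA, hyb⟩ := exists_small_kernel A' N' (by omega)
    (by
      rintro a (_ | i)
      · exact hr a
      · exact (hA a i).trans (by omega))
    (fun o => o.elim (-1) zS) (fun h => by simpa using congrFun h none) (by
      ext a
      rw [mulA']
      simp [r])
  have hyA' : ∀ a, r a * y none +
      (A.submatrix id (fun i : S => (i : ι))).mulVec (fun i => y (some i)) a = 0 := fun a => by
    rw [← mulA', hyA]; rfl
  have hc : y none ≠ 0 := by
    intro hc
    have := indep (fun i => y (some i)) (by ext a; simpa [hc] using hyA' a)
    apply hy0
    ext o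
    rcases o with _ | i
    · exact hc
    · exact congrFun this i
  have hcz := indep (y none • zS + fun i => y (some i)) (by
    ext a
    rw [Matrix.mulVec_add, Matrix.mulVec_smul, Pi.add_apply, Pi.smul_apply, smul_eq_mul, mul_comm]
    exact hyA' a)
  have h1 : y none * (z i : ℤ) + y (some ⟨i, hi⟩) = 0 := congrFun hcz ⟨i, hi⟩
  have h2 : (y (some ⟨i, hi⟩)).natAbs = (y none).natAbs * z i := by
    rw [← Int.natAbs_natCast (z i), ← Int.natAbs_mul]
    omega
  calc z i ≤ (y none).natAbs * z i := Nat.le_mul_of_pos_left _ (Int.natAbs_pos.mpr hc)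
    _ = _ := h2.symm
    _ ≤ _ := hyb _
    _ ≤ _ := by
      simp only [Fintype.card_option, Fintype.card_coe, Fintype.card_fin]
      gcongr

end GenUnbound

namespace GenUnbound

/-! ### Decomposing walks in a finite graph into a skeleton and loops -/

section Walks

variable {G H : Type*} [AddCommGroup G] [AddCommGroup H]

/-- The nodes visited by the walk from `h` with steps `φ t`, for `t` in a list. -/
def trace (φ : G →+ H) (h : H) : List G → List H
  | [] => [h]
  | t :: p => h :: trace φ (h + φ t) p

variable (φ : G →+ H)

lemma start_mem_trace (h : H) (p : List G) : h ∈ trace φ h p := by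
  cases p <;> simp [trace]

lemma mem_trace_append {x h : H} {p q : List G} :
    x ∈ trace φ h (p ++ q) ↔ x ∈ trace φ h p ∨ x ∈ trace φ (h + φ p.sum) q := by
  induction p generalizing h with
  | nil =>
    simp only [List.nil_append, List.sum_nil, map_zero, add_zero, trace, List.mem_singleton]
    constructor
    · exact Or.inr
    · rintro (rfl | hx)
      · exact start_mem_trace φ _ _
      · exact hx
  | cons t p ih =>
    simp only [List.cons_append, trace, List.mem_cons, ih, List.sum_cons, map_add, add_assoc,
      or_assoc]

lemma end_mem_trace (h : H) (p : List G) : h + φ p.sum ∈ trace φ h p := by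
  rw [← List.append_nil p, mem_trace_append]
  exact Or.inr (by simp [trace])

lemma length_trace (h : H) (p : List G) : (trace φ h p).length = p.length + 1 := by
  induction p generalizing h with
  | nil => rfl
  | cons t p ih => simp [trace, ih]

lemma exists_append_of_mem_trace {x h : H} {p : List G} (hx : x ∈ trace φ h p) :
    ∃ p₁ p₂, p = p₁ ++ p₂ ∧ x = h + φ p₁.sum := by
  induction p generalizing h with
  | nil => exact ⟨[], [], rfl, by simpa [trace] using hx⟩
  | cons t p ih =>
    rcases List.mem_cons.mp hx with rfl | hx
    · exact ⟨[], t :: p, rfl, by simp⟩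
    · obtain ⟨p₁, p₂, rfl, rfl⟩ := ih hx
      exact ⟨t :: p₁, p₂, rfl, by simp [add_assoc]⟩

lemma trace_append_singleton (h : H) (p : List G) (t : G) :
    trace φ h (p ++ [t]) = trace φ h p ++ [h + φ p.sum + φ t] := by
  induction p generalizing h with
  | nil => simp [trace]
  | cons s p ih => simp [trace, ih, add_assoc]

/-- A walk over `T` from `h` to itself, inside `F`. -/
structure IsLoop (T : Finset G) (F : Finset H) (h : H) (p : List G) : Prop where
  mem : ∀ t ∈ p, t ∈ T
  trace_mem : ∀ x ∈ trace φ h p, x ∈ F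
  map_sum : φ p.sum = 0

variable {φ}

/-- Loops anchored at visited nodes can be inserted into a walk. -/
lemma exists_insert_loops {T : Finset G} {F : Finset H} {h : H} (p : List G)
    (hT : ∀ t ∈ p, t ∈ T) (hF : ∀ x ∈ trace φ h p, x ∈ F) (L : List (List G))
    (hL : ∀ l ∈ L, ∃ x ∈ trace φ h p, IsLoop φ T F x l) :
    ∃ q : List G, (∀ t ∈ q, t ∈ T) ∧ (∀ x ∈ trace φ h q, x ∈ F) ∧
      (∀ x ∈ trace φ h p, x ∈ trace φ h q) ∧
      q.sum = p.sum + (L.map List.sum).sum ∧ q.length = p.length + (L.map List.length).sum := by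
  induction L with
  | nil => exact ⟨p, hT, hF, fun _ => id, by simp, by simp⟩
  | cons l L ih =>
    obtain ⟨q, hqT, hqF, hpq, hsum, hlen⟩ := ih fun l' hl' => hL l' (List.mem_cons_of_mem _ hl')
    obtain ⟨x, hx, hl⟩ := hL l List.mem_cons_self
    obtain ⟨q₁, q₂, rfl, rfl⟩ := exists_append_of_mem_trace φ (hpq x hx)
    have e : h + φ q₁.sum + φ l.sum = h + φ q₁.sum := by rw [hl.map_sum, add_zero]
    refine ⟨q₁ ++ (l ++ q₂), ?_, ?_, ?_, ?_, ?_⟩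
    · intro t ht
      rcases List.mem_append.mp ht with ht | ht
      · exact hqT t (List.mem_append_left _ ht)
      rcases List.mem_append.mp ht with ht | ht
      · exact hl.mem t ht
      · exact hqT t (List.mem_append_right _ ht)
    · intro y hy
      simp only [mem_trace_append, e] at hy hqF
      rcases hy with hy | hy | hy
      · exact hqF y (Or.inl hy)
      · exact hl.trace_mem y hy
      · exact hqF y (Or.inr hy)
    · intro y hy
      have := hpq y hy
      simp only [mem_trace_append, e] at this ⊢
      tauto
    · simp only [List.sum_append, List.map_cons, List.sum_cons] at hsum ⊢
      calc q₁.sum + (l.sum + q₂.sum) = (q₁.sum + q₂.sum) + l.sum := by abel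
        _ = _ := by rw [hsum]; abel
    · simp only [List.length_append, List.map_cons, List.sum_cons] at hlen ⊢
      omega

/-- A walk in a finite set of nodes decomposes into a short walk and short loops anchored at
nodes visited by the short walk. -/
lemma exists_skeleton [DecidableEq H] {T : Finset G} {F : Finset H} {h : H} (p : List G)
    (hT : ∀ t ∈ p, t ∈ T) (hF : ∀ x ∈ trace φ h p, x ∈ F) :
    ∃ (q : List G) (L : List (List G)), (∀ t ∈ q, t ∈ T) ∧ (∀ x ∈ trace φ h q, x ∈ F) ∧
      φ q.sum = φ p.sum ∧ q.length ≤ F.card * F.card + F.card ∧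
      (∀ l ∈ L, l.length ≤ F.card ∧ ∃ x ∈ trace φ h q, IsLoop φ T F x l) ∧
      p.sum = q.sum + (L.map List.sum).sum := by
  -- Invariant of a left-to-right scan: `q` already visits every node kept so far, and the tail `r`
  -- repeats no node. Removing loops from `r` therefore never removes an anchor of an earlier loop.
  -- Each new node lengthens `q` by at most |F|.
  suffices ∃ (q r : List G) (L : List (List G)), (∀ t ∈ q ++ r, t ∈ T) ∧
      (∀ x ∈ trace φ h (q ++ r), x ∈ F) ∧ φ (q ++ r).sum = φ p.sum ∧
      (∀ x ∈ trace φ h (q ++ r), x ∈ trace φ h q) ∧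
      (trace φ (h + φ q.sum) r).Nodup ∧
      q.length ≤ (trace φ h q).toFinset.card * F.card ∧
      (∀ l ∈ L, l.length ≤ F.card ∧ ∃ x ∈ trace φ h q, IsLoop φ T F x l) ∧
      p.sum = (q ++ r).sum + (L.map List.sum).sum by
    obtain ⟨q, r, L, h1, h2, h3, h4, h5, h6, h7, h8⟩ := this
    refine ⟨q ++ r, L, h1, h2, h3, ?_, fun l hl => ⟨(h7 l hl).1, ?_⟩, h8⟩
    · have hr : r.length + 1 ≤ F.card := by
        rw [← length_trace φ (h + φ q.sum) r, ← List.toFinset_card_of_nodup h5]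
        refine Finset.card_le_card fun x hx => h2 x ?_
        rw [mem_trace_append]
        exact Or.inr (List.mem_toFinset.mp hx)
      have hq : (trace φ h q).toFinset.card ≤ F.card := Finset.card_le_card fun x hx => h2 x <| by
        rw [mem_trace_append]
        exact Or.inl (List.mem_toFinset.mp hx)
      have := Nat.mul_le_mul_right F.card hq
      rw [List.length_append]
      omega
    · obtain ⟨x, hx, hl⟩ := (h7 l hl).2
      exact ⟨x, by rw [mem_trace_append]; exact Or.inl hx, hl⟩
  induction p using List.reverseRecOn with
  | nil =>
    refine ⟨[], [], [], by simp, by simpa using hF, by simp, by simp, by simp [trace], by simp,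
      by simp, by simp⟩
  | append_singleton p t ih =>
    obtain ⟨q, r, L, h1, h2, h3, h4, h5, h6, h7, h8⟩ := ih
      (fun s hs => hT s (List.mem_append_left _ hs))
      (fun x hx => hF x (by rw [mem_trace_append]; exact Or.inl hx))
    have ht : t ∈ T := hT t (by simp)
    have hc : h + φ (q ++ r).sum + φ t ∈ F := by
      have := end_mem_trace φ h (p ++ [t])
      refine hF _ ?_
      rw [h3]
      simpa [add_assoc] using this
    have hrN : r.length + 1 ≤ F.card := by
      rw [← length_trace φ (h + φ q.sum) r, ← List.toFinset_card_of_nodup h5]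
      refine Finset.card_le_card fun x hx => h2 x ?_
      rw [mem_trace_append]
      exact Or.inr (List.mem_toFinset.mp hx)
    have h1t : ∀ s ∈ q ++ r ++ [t], s ∈ T := by
      intro s hs
      rcases List.mem_append.mp hs with hs | hs
      · exact h1 s hs
      · rwa [List.mem_singleton.mp hs]
    have h2t : ∀ x ∈ trace φ h (q ++ r ++ [t]), x ∈ F := by
      intro x hx
      rw [trace_append_singleton] at hx
      rcases List.mem_append.mp hx with hx | hx
      · exact h2 x hx
      · rwa [List.mem_singleton.mp hx]
    have h3t : φ (q ++ r ++ [t]).sum = φ (p ++ [t]).sum := by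
      rw [List.sum_append, List.sum_append (l₁ := p), map_add, map_add, h3]
    have h8t : (p ++ [t]).sum = (q ++ r ++ [t]).sum + (L.map List.sum).sum := by
      rw [List.sum_append, List.sum_append (l₁ := q ++ r), h8]; abel
    by_cases hvis : h + φ (q ++ r).sum + φ t ∈ trace φ h q
    · have h4t : ∀ x ∈ trace φ h (q ++ r ++ [t]), x ∈ trace φ h q := by
        intro x hx
        rw [trace_append_singleton] at hx
        rcases List.mem_append.mp hx with hx | hx
        · exact h4 x hx
        · rwa [List.mem_singleton.mp hx]
      -- If the tail has already met the node, the piece since that visit is a loop, stored in `L`;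
      -- otherwise the tail grows by `t`.
      by_cases htail : h + φ (q ++ r).sum + φ t ∈ trace φ (h + φ q.sum) r
      · obtain ⟨r₁, r₂, rfl, hr⟩ := exists_append_of_mem_trace φ htail
        have hsub : ∀ x ∈ trace φ h (q ++ r₁), x ∈ trace φ h (q ++ (r₁ ++ r₂)) := by
          intro x hx
          rw [← List.append_assoc, mem_trace_append]
          exact Or.inl hx
        have hend : φ (q ++ r₁).sum = φ (p ++ [t]).sum := by
          rw [← h3t]
          simp only [List.sum_append, List.sum_singleton, map_add] at hr ⊢
          rw [← add_right_inj h, ← add_assoc, ← hr]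
          abel
        refine ⟨q, r₁, (r₂ ++ [t]) :: L, ?_, fun x hx => h2 x (hsub x hx), hend,
          fun x hx => h4 x (hsub x hx), ?_, h6, ?_, ?_⟩
        · intro s hs
          refine h1 s ?_
          rw [← List.append_assoc]
          exact List.mem_append_left _ hs
        · have : ∀ (g : H) (a b : List G), (trace φ g (a ++ b)).Nodup → (trace φ g a).Nodup := by
            intro g a b
            induction b using List.reverseRecOn with
            | nil => simp
            | append_singleton b s ihb =>
              rw [← List.append_assoc, trace_append_singleton]
              exact fun hn => ihb (List.Nodup.of_append_left hn)
          exact this _ _ _ h5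
        · intro l hl
          rcases List.mem_cons.mp hl with rfl | hl
          · refine ⟨by simp only [List.length_append, List.length_singleton] at hrN ⊢; omega,
              _, hvis, ?_, ?_, ?_⟩
            · intro s hs
              refine h1t s ?_
              rw [List.append_assoc, List.append_assoc]
              exact List.mem_append_right _ (List.mem_append_right _ hs)
            · intro x hx
              refine h2t x ?_
              rw [List.append_assoc, List.append_assoc, mem_trace_append, mem_trace_append]
              rw [hr] at hx
              exact Or.inr (Or.inr hx)
            · rw [List.sum_append, map_add]
              simp only [List.sum_append, List.sum_singleton, map_add] at hr ⊢
              have e := sub_eq_zero.mpr hr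
              rw [← e]; abel
          · exact h7 l hl
        · rw [h8t]
          simp only [List.sum_append, List.map_cons, List.sum_cons]
          abel
      · refine ⟨q, r ++ [t], L, ?_, ?_, ?_, ?_, ?_, h6, h7, ?_⟩
        · rwa [← List.append_assoc]
        · rwa [← List.append_assoc]
        · rwa [← List.append_assoc]
        · rwa [← List.append_assoc]
        · rw [trace_append_singleton, List.nodup_append]
          refine ⟨h5, by simp, ?_⟩
          intro a ha b hb hab
          rw [List.mem_singleton.mp hb] at hab
          apply htail
          rw [List.sum_append, map_add, ← add_assoc, ← hab]
          exact ha
        · rwa [← List.append_assoc]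
    -- A node not visited before: the tail is absorbed into `q`, at a cost of at most |F|
    -- transitions paid for by the new node.
    · refine ⟨q ++ r ++ [t], [], L, ?_, ?_, ?_, ?_, ?_, ?_, ?_, ?_⟩
      · rwa [List.append_nil]
      · rwa [List.append_nil]
      · rwa [List.append_nil]
      · rw [List.append_nil]; exact fun _ => id
      · simp [trace]
      · have hcard : (trace φ h q).toFinset.card + 1 ≤ (trace φ h (q ++ r ++ [t])).toFinset.card := by
          rw [← Finset.card_insert_of_notMem (a := h + φ (q ++ r).sum + φ t) (by simpa using hvis)]
          refine Finset.card_le_card fun x hx => ?_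
          rw [List.mem_toFinset, trace_append_singleton, List.mem_append]
          rcases Finset.mem_insert.mp hx with rfl | hx
          · right; simp
          · left
            rw [mem_trace_append]
            exact Or.inl (List.mem_toFinset.mp hx)
        have := Nat.mul_le_mul_right F.card hcard
        rw [add_mul, one_mul] at this
        simp only [List.length_append, List.length_singleton]
        omega
      · intro l hl
        obtain ⟨hlen, x, hx, hl⟩ := h7 l hl
        refine ⟨hlen, x, ?_, hl⟩
        rw [List.append_assoc, mem_trace_append]
        exact Or.inl hx
      · rwa [List.append_nil]

end Walks

end GenUnbound

/-! ### Short walks with effects in prescribed sets -/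

namespace GenUnbound

/-- A set of integers each of whose elements `e` can be written `a + σ * s` with `|a| ≤ R`,
`|σ| ≤ 1`, `s` natural, such that the set contains the whole progression. -/
def Tame (R : ℕ) (S : Set ℤ) : Prop :=
  ∀ e ∈ S, ∃ a σ : ℤ, a.natAbs ≤ R ∧ σ.natAbs ≤ 1 ∧ (∃ s : ℕ, e = a + σ * s) ∧
    ∀ s : ℕ, a + σ * s ∈ S

/-- A bound on the coefficients of the loops in `exists_short_walk`. -/
def loopBound (n Δ R N : ℕ) : ℕ :=
  ((n + 1) * (R + (N * N + N) * Δ +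
    ((2 * (N * Δ) + 1) ^ n + n) * ((n + 1) * (N * Δ)) ^ n * (N * Δ) + N * Δ)) ^ n

/-- The length bound of `exists_short_walk`. -/
def walkBound (n Δ R N : ℕ) : ℕ :=
  N * N + N + (2 * (N * Δ) + 1) ^ n * (loopBound n Δ R N * N)

variable {n : ℕ}

lemma natAbs_sum_le {T : Finset (Fin n → ℤ)} {Δ : ℕ} (hΔ : ∀ t ∈ T, ∀ j, (t j).natAbs ≤ Δ)
    (p : List (Fin n → ℤ)) (hp : ∀ t ∈ p, t ∈ T) (j : Fin n) :
    (p.sum j).natAbs ≤ p.length * Δ := by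
  induction p with
  | nil => simp
  | cons t p ih =>
    have h1 := ih fun s hs => hp s (List.mem_cons_of_mem _ hs)
    have h2 := hΔ t (hp t List.mem_cons_self) j
    rw [List.sum_cons, Pi.add_apply, List.length_cons, add_mul, one_mul]
    have := Int.natAbs_add_le (t j) (p.sum j)
    omega

lemma card_le_of_natAbs_le (W : Finset (Fin n → ℤ)) (D : ℕ) (hW : ∀ w ∈ W, ∀ j, (w j).natAbs ≤ D) :
    W.card ≤ (2 * D + 1) ^ n := by
  have hsub : W ⊆ Fintype.piFinset fun _ : Fin n => Finset.Icc (-(D : ℤ)) D := by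
    intro w hw
    rw [Fintype.mem_piFinset]
    intro j
    have := hW w hw j
    rw [Finset.mem_Icc]
    omega
  refine (Finset.card_le_card hsub).trans ?_
  rw [Fintype.card_piFinset]
  simp only [Int.card_Icc, Finset.prod_const, Finset.card_univ, Fintype.card_fin]
  refine Nat.pow_le_pow_left ?_ n
  omega

lemma sum_map_flatMap_replicate {α β M : Type*} [AddCommMonoid M] (l : List α) (c : α → ℕ)
    (f : α → β) (g : β → M) :
    ((l.flatMap fun a => List.replicate (c a) (f a)).map g).sum =
      (l.map fun a => c a • g (f a)).sum := by
  induction l with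
  | nil => simp
  | cons a l ih => simp [ih]

/-- A walk in a finite set of nodes can be replaced by a short one with the same ends, whose
effect stays in prescribed tame sets. -/
lemma exists_short_walk {H : Type*} [AddCommGroup H] {φ : (Fin n → ℤ) →+ H}
    {T : Finset (Fin n → ℤ)} {Δ R N : ℕ} (hΔ1 : 1 ≤ Δ) (hΔ : ∀ t ∈ T, ∀ j, (t j).natAbs ≤ Δ)
    {F : Finset H} (hN : F.card ≤ N) {h : H} (p : List (Fin n → ℤ)) (hT : ∀ t ∈ p, t ∈ T)
    (hF : ∀ x ∈ trace φ h p, x ∈ F) {J : Fin n → Set ℤ} (hJ : ∀ j, Tame R (J j))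
    (hp : ∀ j, p.sum j ∈ J j) :
    ∃ q : List (Fin n → ℤ), (∀ t ∈ q, t ∈ T) ∧ (∀ x ∈ trace φ h q, x ∈ F) ∧
      φ q.sum = φ p.sum ∧ (∀ j, q.sum j ∈ J j) ∧ q.length ≤ walkBound n Δ R N := by
  classical
  obtain ⟨q, L, hqT, hqF, hqφ, hqlen, hL, hsum⟩ := exists_skeleton p hT hF
  have hN1 : 1 ≤ N := le_trans (Finset.card_pos.mpr ⟨h, hF h (start_mem_trace φ h p)⟩) hN
  have hqlen' : q.length ≤ N * N + N := hqlen.trans (by gcongr)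
  have hD1 : 1 ≤ N * Δ := Nat.mul_pos hN1 hΔ1
  choose a σ ha hσ hs hall using fun j => hJ j _ (hp j)
  choose s hs using hs
  -- Only the distinct loop effects matter: loops of equal effect are interchangeable, all being
  -- anchored on the skeleton. Their entries are at most NΔ, so there are at most (2NΔ+1)^n of them.
  let W : Finset (Fin n → ℤ) := (L.map List.sum).toFinset
  have hrep : ∀ w : W, ∃ l ∈ L, l.sum = w := fun w => by
    have := w.2
    simp only [W, List.mem_toFinset, List.mem_map] at this
    exact this
  choose rep hrepL hrepsum using hrep
  have hWD : ∀ w ∈ W, ∀ j, (w j).natAbs ≤ N * Δ := by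
    intro w hw j
    rw [show w = (rep ⟨w, hw⟩).sum from (hrepsum ⟨w, hw⟩).symm]
    obtain ⟨hlen, x, -, hl⟩ := hL _ (hrepL ⟨w, hw⟩)
    refine (natAbs_sum_le hΔ _ hl.mem j).trans ?_
    gcongr
    exact hlen.trans hN
  have hWcard := card_le_of_natAbs_le W (N * Δ) hWD
  -- Unknowns: the multiplicity of each loop effect and, for each coordinate j, the position s_j on
  -- the progression a_j + σ_j s_j. The equations say that the skeleton plus the loops have effect
  -- a_j + σ_j s_j; the given walk supplies the solution `x` below.
  let A : Matrix (Fin n) (W ⊕ Fin n) ℤ := fun j o =>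
    Sum.elim (fun w : W => (w : Fin n → ℤ) j) (fun j' => if j = j' then -σ j else 0) o
  have hA : ∀ j o, (A j o).natAbs ≤ N * Δ := by
    rintro j (w | j')
    · exact hWD w w.2 j
    · simp only [A, Sum.elim_inr]
      split_ifs
      · rw [Int.natAbs_neg]; exact (hσ j).trans hD1
      · simp
  have mulA : ∀ (x : W ⊕ Fin n → ℕ) j, A.mulVec (fun o => (x o : ℤ)) j =
      ∑ w : W, (w : Fin n → ℤ) j * (x (Sum.inl w) : ℤ) - σ j * x (Sum.inr j) := by
    intro x j
    simp [A, Matrix.mulVec, dotProduct, Fintype.sum_sum_type, ite_mul, sub_eq_add_neg]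
  let x : W ⊕ Fin n → ℕ := Sum.elim (fun w : W => (L.map List.sum).count (w : Fin n → ℤ)) s
  have hLsum : ∀ j, (L.map List.sum).sum j = ∑ w : W, (w : Fin n → ℤ) j * (x (Sum.inl w) : ℤ) := by
    intro j
    rw [Finset.sum_list_count, Finset.sum_apply, ← Finset.sum_coe_sort]
    refine Finset.sum_congr rfl fun w _ => ?_
    simp [x, mul_comm]
  have hx : ∀ j, A.mulVec (fun o => (x o : ℤ)) j = a j - q.sum j := by
    intro j
    rw [mulA, ← hLsum]
    have h1 := hs j
    rw [hsum, Pi.add_apply] at h1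
    simp only [x, Sum.elim_inr]
    linarith
  obtain ⟨z, hz, hzb⟩ := exists_small_solution A (N * Δ) (R + (N * N + N) * Δ) hD1 hA x (by
    intro j
    rw [hx]
    have h1 := natAbs_sum_le hΔ q hqT j
    have h2 := Nat.mul_le_mul_right Δ hqlen'
    have h3 := ha j
    omega)
  let L' : List (List (Fin n → ℤ)) :=
    (Finset.univ : Finset W).toList.flatMap fun w => List.replicate (z (Sum.inl w)) (rep w)
  have hL' : ∀ l ∈ L', l ∈ L := by
    intro l hl
    simp only [L', List.mem_flatMap, List.mem_replicate] at hl
    obtain ⟨w, -, -, rfl⟩ := hl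
    exact hrepL w
  have hL'sum : (L'.map List.sum).sum = ∑ w : W, z (Sum.inl w) • (w : Fin n → ℤ) := by
    simp only [L', sum_map_flatMap_replicate, hrepsum]
    exact Finset.sum_map_toList _ _
  have hL'len : (L'.map List.length).sum = ∑ w : W, z (Sum.inl w) • (rep w).length := by
    simp only [L', sum_map_flatMap_replicate]
    exact Finset.sum_map_toList _ _
  obtain ⟨r, hrT, hrF, -, hrsum, hrlen⟩ := exists_insert_loops q hqT hqF L' fun l hl =>
    (hL l (hL' l hl)).2
  refine ⟨r, hrT, hrF, ?_, ?_, ?_⟩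
  · rw [hrsum, map_add, hqφ, hL'sum, map_sum]
    rw [Finset.sum_eq_zero, add_zero]
    intro w _
    obtain ⟨-, y, -, hl⟩ := hL _ (hrepL w)
    rw [map_nsmul, ← hrepsum, hl.map_sum, smul_zero]
  · intro j
    have h1 := congrFun hz j
    rw [hx, mulA] at h1
    have h2 : r.sum j = a j + σ j * z (Sum.inr j) := by
      rw [hrsum, Pi.add_apply, hL'sum, Finset.sum_apply]
      have : ∑ w : W, (z (Sum.inl w) • (w : Fin n → ℤ)) j =
          ∑ w : W, (w : Fin n → ℤ) j * (z (Sum.inl w) : ℤ) :=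
        Finset.sum_congr rfl fun w _ => by simp [mul_comm]
      rw [this]
      linarith
    rw [h2]
    exact hall j _
  · rw [hrlen, hL'len, walkBound]
    refine Nat.add_le_add hqlen' ?_
    have hzX : ∀ o, z o ≤ loopBound n Δ R N := by
      intro o
      refine (hzb o).trans ?_
      rw [loopBound, Fintype.card_sum, Fintype.card_coe, Fintype.card_fin]
      gcongr
    calc ∑ w : W, z (Sum.inl w) • (rep w).length
        ≤ ∑ _w : W, loopBound n Δ R N * N := by
          refine Finset.sum_le_sum fun w _ => ?_
          rw [smul_eq_mul]
          exact Nat.mul_le_mul (hzX _) ((hL _ (hrepL w)).1.trans hN)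
      _ = W.card * (loopBound n Δ R N * N) := by simp
      _ ≤ _ := Nat.mul_le_mul_right _ hWcard

end GenUnbound

/-! ### Lists of segments and the induction on the nonnegative coordinates -/

namespace GenUnbound

variable {n : ℕ}

/-- Along the path `p` from `v`, the coordinates in `A` are nonnegative. -/
def Safe (A : Finset (Fin n)) (v : Fin n → ℤ) (p : List (Fin n → ℤ)) : Prop :=
  ∀ x ∈ trace (AddMonoidHom.id (Fin n → ℤ)) v p, ∀ j ∈ A, 0 ≤ x j

/-- Along the path `p` from `v`, the coordinates in `A` are smaller than `b`. -/
def Below (b : ℕ) (A : Finset (Fin n)) (v : Fin n → ℤ) (p : List (Fin n → ℤ)) : Prop :=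
  ∀ x ∈ trace (AddMonoidHom.id (Fin n → ℤ)) v p, ∀ j ∈ A, x j < b

lemma mem_trace_id {x v : Fin n → ℤ} {p : List (Fin n → ℤ)} :
    x ∈ trace (AddMonoidHom.id (Fin n → ℤ)) v p ↔ ∃ p₁ p₂, p = p₁ ++ p₂ ∧ x = v + p₁.sum := by
  constructor
  · exact exists_append_of_mem_trace _
  · rintro ⟨p₁, p₂, rfl, rfl⟩
    rw [mem_trace_append]
    exact Or.inl (end_mem_trace _ v p₁)

lemma safe_append {A : Finset (Fin n)} {v : Fin n → ℤ} {p q : List (Fin n → ℤ)} :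
    Safe A v (p ++ q) ↔ Safe A v p ∧ Safe A (v + p.sum) q := by
  simp only [Safe, mem_trace_append, AddMonoidHom.id_apply, or_imp, forall_and]

lemma below_append {b : ℕ} {A : Finset (Fin n)} {v : Fin n → ℤ} {p q : List (Fin n → ℤ)} :
    Below b A v (p ++ q) ↔ Below b A v p ∧ Below b A (v + p.sum) q := by
  simp only [Below, mem_trace_append, AddMonoidHom.id_apply, or_imp, forall_and]

lemma Safe.mono {A A' : Finset (Fin n)} {v w : Fin n → ℤ} {p : List (Fin n → ℤ)}
    (h : Safe A v p) (hA : A' ⊆ A) (hvw : ∀ j ∈ A', v j ≤ w j) : Safe A' w p := by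
  intro x hx j hj
  obtain ⟨p₁, p₂, rfl, rfl⟩ := mem_trace_id.mp hx
  have h1 := h (v + p₁.sum) (mem_trace_id.mpr ⟨p₁, p₂, rfl, rfl⟩) j (hA hj)
  have h2 := hvw j hj
  simp only [Pi.add_apply] at h1 ⊢
  linarith

lemma map_trace {H : Type*} [AddCommGroup H] (φ : (Fin n → ℤ) →+ H) (v : Fin n → ℤ)
    (p : List (Fin n → ℤ)) :
    trace φ (φ v) p = (trace (AddMonoidHom.id (Fin n → ℤ)) v p).map φ := by
  induction p generalizing v with
  | nil => rfl
  | cons t p ih =>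
    simp only [trace, List.map_cons, AddMonoidHom.id_apply]
    rw [← ih, map_add]

lemma tame_univ (R : ℕ) : Tame R Set.univ := fun e _ =>
  ⟨0, e.sign, by simp, by rcases Int.sign_trichotomy e with h | h | h <;> simp [h],
    ⟨e.natAbs, by rw [zero_add, Int.sign_mul_natAbs]⟩, fun _ => trivial⟩

lemma neg_le_sum {T : Finset (Fin n → ℤ)} {d : ℕ} (hd : ∀ t ∈ T, ∀ j, -(d : ℤ) ≤ t j)
    {p : List (Fin n → ℤ)} (hp : ∀ t ∈ p, t ∈ T) (j : Fin n) :
    -((d * p.length : ℕ) : ℤ) ≤ p.sum j := by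
  induction p with
  | nil => simp
  | cons t p ih =>
    have h1 := ih fun s hs => hp s (List.mem_cons_of_mem _ hs)
    have h2 := hd t (hp t List.mem_cons_self) j
    rw [List.sum_cons, Pi.add_apply, List.length_cons, mul_add, mul_one]
    push_cast at h1 ⊢
    linarith

/-- A transition lowers a coordinate by at most `d`, so a coordinate that starts at `d` times the
length cannot become negative. -/
lemma Safe.of_erase {T : Finset (Fin n → ℤ)} {d : ℕ} (hd : ∀ t ∈ T, ∀ j, -(d : ℤ) ≤ t j)
    {A : Finset (Fin n)} {j : Fin n} {v : Fin n → ℤ} {p : List (Fin n → ℤ)}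
    (hp : ∀ t ∈ p, t ∈ T) (h : Safe (A.erase j) v p) (hv : ((d * p.length : ℕ) : ℤ) ≤ v j) :
    Safe A v p := by
  intro x hx k hk
  by_cases hkj : k = j
  · subst hkj
    obtain ⟨p₁, p₂, rfl, rfl⟩ := mem_trace_id.mp hx
    have h1 := neg_le_sum hd (fun t ht => hp t (List.mem_append_left _ ht)) k
    have h2 : d * p₁.length ≤ d * (p₁ ++ p₂).length := by gcongr; simp
    rw [Pi.add_apply]
    have h3 : ((d * p₁.length : ℕ) : ℤ) ≤ ((d * (p₁ ++ p₂).length : ℕ) : ℤ) := by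
      exact_mod_cast h2
    linarith
  · exact h x hx k (Finset.mem_erase.mpr ⟨hkj, hk⟩)

/-- A bounded safe path can be replaced by a short one with the same effect on `A`. -/
lemma exists_short_safe {T : Finset (Fin n → ℤ)} {Δ R b : ℕ} (hΔ1 : 1 ≤ Δ)
    (hΔ : ∀ t ∈ T, ∀ j, (t j).natAbs ≤ Δ) (hb : 1 ≤ b) {A : Finset (Fin n)} {v : Fin n → ℤ}
    {p : List (Fin n → ℤ)} (hT : ∀ t ∈ p, t ∈ T) (hs : Safe A v p) (hbd : Below b A v p)
    {J : Fin n → Set ℤ} (hJ : ∀ j, Tame R (J j)) (hp : ∀ j, p.sum j ∈ J j) :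
    ∃ q : List (Fin n → ℤ), (∀ t ∈ q, t ∈ T) ∧ Safe A v q ∧ (∀ j ∈ A, q.sum j = p.sum j) ∧
      (∀ j, q.sum j ∈ J j) ∧ q.length ≤ walkBound n Δ R (b ^ n) := by
  -- Project to the coordinates in `A`, where the walk stays in the box [0, b)^A with at most b^n
  -- points. The other coordinates are free along the way; only their total effect is constrained.
  let φ : (Fin n → ℤ) →+ (A → ℤ) :=
    { toFun := fun v j => v j, map_zero' := rfl, map_add' := fun _ _ => rfl }
  let F : Finset (A → ℤ) := Fintype.piFinset fun _ => Finset.Ico 0 (b : ℤ)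
  have hF : F.card ≤ b ^ n := by
    rw [Fintype.card_piFinset]
    simp only [Int.card_Ico, Finset.prod_const, Finset.card_univ, Fintype.card_coe, sub_zero,
      Int.toNat_natCast]
    exact Nat.pow_le_pow_right hb (by simpa using Finset.card_le_univ A)
  obtain ⟨q, hqT, hqF, hqφ, hqJ, hqlen⟩ := exists_short_walk (φ := φ) hΔ1 hΔ hF (h := φ v) p hT (by
    intro y hy
    rw [map_trace] at hy
    obtain ⟨x, hx, rfl⟩ := List.mem_map.mp hy
    rw [Fintype.mem_piFinset]
    exact fun j => Finset.mem_Ico.mpr ⟨hs x hx j j.2, hbd x hx j j.2⟩) hJ hp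
  refine ⟨q, hqT, fun x hx j hj => ?_, fun j hj => congrFun hqφ ⟨j, hj⟩, hqJ, hqlen⟩
  have := hqF (φ x) (by rw [map_trace]; exact List.mem_map_of_mem hx)
  exact (Finset.mem_Ico.mp (Fintype.mem_piFinset.mp this ⟨j, hj⟩)).1

/-- Cut at the first point where a coordinate of `A` reaches `b`. Up to the last transition before
the cut, the path is bounded and can be shortened. -/
lemma below_or_exists_exceed (b : ℕ) (A : Finset (Fin n)) (v : Fin n → ℤ)
    (p : List (Fin n → ℤ)) :
    Below b A v p ∨ ∃ p₁ p₂, p = p₁ ++ p₂ ∧ (∃ j ∈ A, (b : ℤ) ≤ (v + p₁.sum) j) ∧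
      (p₁ = [] ∨ ∃ r t, p₁ = r ++ [t] ∧ Below b A v r) := by
  by_cases hv : ∃ j ∈ A, (b : ℤ) ≤ v j
  · exact Or.inr ⟨[], p, rfl, by simpa using hv, Or.inl rfl⟩
  push Not at hv
  induction p using List.reverseRecOn with
  | nil =>
    left
    intro x hx
    rw [trace, List.mem_singleton] at hx
    exact hx ▸ hv
  | append_singleton p t ih =>
    rcases ih with h | ⟨p₁, p₂, rfl, h⟩
    · by_cases he : ∃ j ∈ A, (b : ℤ) ≤ (v + (p ++ [t]).sum) j
      · exact Or.inr ⟨p ++ [t], [], by simp, he, Or.inr ⟨p, t, rfl, h⟩⟩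
      · left
        push Not at he
        intro x hx
        rw [trace_append_singleton] at hx
        rcases List.mem_append.mp hx with hx | hx
        · exact h x hx
        · rw [List.mem_singleton.mp hx]
          simpa [add_assoc] using he
    · exact Or.inr ⟨p₁, p₂ ++ [t], by simp, h⟩

/-- `Sol T S v m`: there are paths of total length `m` from `v` through the segments in `S`, where
a segment `(A, J)` asks for a path that is safe for `A` and whose second part has an effect in `J`. -/
def Sol (T : Finset (Fin n → ℤ)) :
    List (Finset (Fin n) × (Fin n → Set ℤ)) → (Fin n → ℤ) → ℕ → Prop
  | [], _, m => m = 0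
  | s :: S, v, m => ∃ (p q : List (Fin n → ℤ)) (m' : ℕ), (∀ t ∈ p ++ q, t ∈ T) ∧
      Safe s.1 v (p ++ q) ∧ (∀ j, q.sum j ∈ s.2 j) ∧ Sol T S (v + (p ++ q).sum) m' ∧
      m = p.length + q.length + m'

/-- The segments in the list have decreasing sets contained in `A`, tame effect sets, and effects
that are nonnegative on the coordinates that have to be nonnegative. -/
def WellFormed (R : ℕ) : Finset (Fin n) → List (Finset (Fin n) × (Fin n → Set ℤ)) → Prop
  | _, [] => True
  | A, s :: S => s.1 ⊆ A ∧ (∀ j ∈ s.1, ∀ e ∈ s.2 j, 0 ≤ e) ∧ (∀ j, Tame R (s.2 j)) ∧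
      WellFormed R s.1 S

/-- Drop the coordinate `j` from the sets of a list of segments. -/
def eraseCoord (j : Fin n) (S : List (Finset (Fin n) × (Fin n → Set ℤ))) :
    List (Finset (Fin n) × (Fin n → Set ℤ)) :=
  S.map fun s => (s.1.erase j, s.2)

variable {T : Finset (Fin n → ℤ)} {S : List (Finset (Fin n) × (Fin n → Set ℤ))}
  {v w : Fin n → ℤ} {m R : ℕ} {A : Finset (Fin n)}

lemma WellFormed.eraseCoord (j : Fin n) (h : WellFormed R A S) :
    WellFormed R (A.erase j) (eraseCoord j S) := by
  induction S generalizing A with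
  | nil => trivial
  | cons s S ih =>
    obtain ⟨h1, h2, h3, h4⟩ := h
    exact ⟨Finset.erase_subset_erase j h1, fun k hk => h2 k (Finset.mem_of_mem_erase hk), h3, ih h4⟩

/-- Effects do not depend on the starting vector, and nonnegativity is only asked on subsets of `A`,
so the same paths work from `w`. -/
lemma Sol.mono (hS : WellFormed R A S) (h : Sol T S v m) (hvw : ∀ j ∈ A, v j ≤ w j) :
    Sol T S w m := by
  induction S generalizing A v w m with
  | nil => exact h
  | cons s S ih =>
    obtain ⟨h1, -, -, h4⟩ := hS
    obtain ⟨p, q, m', hT, hs, hJ, hrest, rfl⟩ := h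
    refine ⟨p, q, m', hT, hs.mono subset_rfl fun j hj => hvw j (h1 hj), hJ, ?_, rfl⟩
    exact ih h4 hrest fun j hj => by simpa using hvw j (h1 hj)

lemma Sol.eraseCoord (j : Fin n) (h : Sol T S v m) : Sol T (eraseCoord j S) v m := by
  induction S generalizing v m with
  | nil => exact h
  | cons s S ih =>
    obtain ⟨p, q, m', hT, hs, hJ, hrest, rfl⟩ := h
    exact ⟨p, q, m', hT, hs.mono (Finset.erase_subset _ _) fun _ _ => le_rfl, hJ, ih hrest, rfl⟩

lemma Sol.of_eraseCoord {d : ℕ} (hd : ∀ t ∈ T, ∀ j, -(d : ℤ) ≤ t j) {j : Fin n}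
    (h : Sol T (GenUnbound.eraseCoord j S) v m) (hv : ((d * m : ℕ) : ℤ) ≤ v j) : Sol T S v m := by
  induction S generalizing v m with
  | nil => exact h
  | cons s S ih =>
    obtain ⟨p, q, m', hT, hs, hJ, hrest, rfl⟩ := h
    refine ⟨p, q, m', hT, Safe.of_erase hd hT hs ?_, hJ, ih hrest ?_, rfl⟩
    · refine le_trans ?_ hv
      rw [List.length_append]
      exact_mod_cast Nat.mul_le_mul_left d (by omega)
    · have := neg_le_sum hd hT j
      rw [List.length_append] at this
      rw [Pi.add_apply]
      push_cast at this hv ⊢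
      linarith

lemma Sol.prepend {s : Finset (Fin n) × (Fin n → Set ℤ)} {r : List (Fin n → ℤ)}
    (h : Sol T (s :: S) (v + r.sum) m) (hT : ∀ t ∈ r, t ∈ T) (hr : Safe s.1 v r) :
    Sol T (s :: S) v (r.length + m) := by
  obtain ⟨p, q, m', hpqT, hs, hJ, hrest, rfl⟩ := h
  refine ⟨r ++ p, q, m', ?_, ?_, hJ, ?_, ?_⟩
  · intro t ht
    rw [List.append_assoc] at ht
    exact (List.mem_append.mp ht).elim (hT t) (hpqT t)
  · rw [List.append_assoc, safe_append]
    exact ⟨hr, hs⟩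
  · rw [List.append_assoc, List.sum_append, ← add_assoc]
    exact hrest
  · rw [List.length_append]; ring

/-- Every solvable list of at most `K` segments with fewer than `i` nonnegative coordinates has a
solution of length at most `L`. -/
def ShortSolutions (T : Finset (Fin n → ℤ)) (R K i L : ℕ) : Prop :=
  ∀ (S : List (Finset (Fin n) × (Fin n → Set ℤ))) (A : Finset (Fin n)) (v : Fin n → ℤ) (m : ℕ),
    WellFormed R A S → A.card < i → S.length ≤ K → Sol T S v m → ∃ m' ≤ L, Sol T S v m'

/-- The case of an excess. The path `p` leading to it is shortened without changing its effect on
`s.1`; its last transition, which crosses the threshold, is kept and accounts for the `+ 1`. Erasing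
the coordinate that is at least `d * L` allows the induction hypothesis, whose solution has length
at most `L` and so cannot exhaust that coordinate. -/
lemma Sol.exists_short_of_exceed {Δ d K i L : ℕ} (hΔ1 : 1 ≤ Δ)
    (hΔ : ∀ t ∈ T, ∀ j, (t j).natAbs ≤ Δ) (hd1 : 1 ≤ d) (hd : ∀ t ∈ T, ∀ j, -(d : ℤ) ≤ t j)
    (hL1 : 1 ≤ L) (hL : ShortSolutions T R K i L) {s : Finset (Fin n) × (Fin n → Set ℤ)}
    (hS : WellFormed R s.1 (s :: S)) (hi : s.1.card ≤ i) (hK : (s :: S).length ≤ K)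
    {p : List (Fin n → ℤ)} (hT : ∀ t ∈ p, t ∈ T) (hp : Safe s.1 v p)
    (hex : ∃ j ∈ s.1, ((d * L : ℕ) : ℤ) ≤ (v + p.sum) j)
    (hbd : p = [] ∨ ∃ r t, p = r ++ [t] ∧ Below (d * L) s.1 v r)
    (h : Sol T (s :: S) (v + p.sum) m) :
    ∃ m' ≤ walkBound n Δ R ((d * L) ^ n) + 1 + L, Sol T (s :: S) v m' := by
  obtain ⟨r, hrT, hr, hrA, hrlen⟩ : ∃ r : List (Fin n → ℤ), (∀ t ∈ r, t ∈ T) ∧ Safe s.1 v r ∧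
      (∀ j ∈ s.1, r.sum j = p.sum j) ∧ r.length ≤ walkBound n Δ R ((d * L) ^ n) + 1 := by
    rcases hbd with rfl | ⟨r, t, rfl, hr⟩
    · exact ⟨[], hT, hp, fun _ _ => rfl, by simp⟩
    · rw [safe_append] at hp
      obtain ⟨q, hqT, hq, hqA, -, hqlen⟩ := exists_short_safe (R := R) hΔ1 hΔ
        (Nat.mul_pos hd1 hL1) (fun t ht => hT t (List.mem_append_left _ ht)) hp.1 hr
        (J := fun _ => Set.univ) (fun _ => tame_univ R) fun _ => trivial
      refine ⟨q ++ [t], ?_, ?_, ?_, by simpa using hqlen⟩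
      · intro u hu
        rcases List.mem_append.mp hu with hu | hu
        · exact hqT u hu
        · exact hT u (List.mem_append_right _ hu)
      · rw [safe_append]
        exact ⟨hq, hp.2.mono subset_rfl fun j hj => by simp [hqA j hj]⟩
      · intro j hj
        simp [hqA j hj]
  obtain ⟨j, hj, hjL⟩ := hex
  have h1 : Sol T (s :: S) (v + r.sum) m := h.mono hS fun k hk => by simp [hrA k hk]
  obtain ⟨m', hm', h2⟩ := hL (GenUnbound.eraseCoord j (s :: S)) (s.1.erase j) (v + r.sum) m
    (hS.eraseCoord j) ((Finset.card_erase_lt_of_mem hj).trans_le hi)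
    (by simpa [GenUnbound.eraseCoord] using hK) (h1.eraseCoord j)
  have h3 : Sol T (s :: S) (v + r.sum) m' := h2.of_eraseCoord hd (by
    rw [Pi.add_apply, hrA j hj, ← Pi.add_apply]
    refine le_trans ?_ hjL
    exact_mod_cast Nat.mul_le_mul_left d hm')
  exact ⟨_, by omega, h3.prepend hrT hr⟩

/-- If the loop `a ++ b` of the first segment is interrupted after `a`, the segments can be solved
from that point on with the rotated loop `b ++ a`. -/
lemma Sol.rotate {s : Finset (Fin n) × (Fin n → Set ℤ)} {a b : List (Fin n → ℤ)}
    (hS : WellFormed R A (s :: S)) (hT : ∀ t ∈ a ++ b, t ∈ T) (hs : Safe s.1 v (a ++ b))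
    (hJ : ∀ j, (a ++ b).sum j ∈ s.2 j) (h : Sol T S (v + (a ++ b).sum) m) :
    ∃ m', Sol T (s :: S) (v + a.sum) m' := by
  obtain ⟨-, hpos, -, hS'⟩ := hS
  have hnn : ∀ j ∈ s.1, 0 ≤ (a ++ b).sum j := fun j hj => hpos j hj _ (hJ j)
  have hcomm : (b ++ a).sum = (a ++ b).sum := by
    rw [List.sum_append, List.sum_append, add_comm]
  have hsa := (safe_append.mp hs).1
  have hsb := (safe_append.mp hs).2
  have hTa : ∀ t ∈ a, t ∈ T := fun t ht => hT t (List.mem_append_left _ ht)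
  have hTb : ∀ t ∈ b, t ∈ T := fun t ht => hT t (List.mem_append_right _ ht)
  obtain ⟨m', hm'⟩ : ∃ m', Sol T S (v + a.sum + (b ++ a).sum) m' := by
    cases S with
    | nil => exact ⟨0, rfl⟩
    | cons s' S =>
      -- After the rotated loop, `b` is run once more in the free part of the next segment. This
      -- reaches v + 2(a + b), which dominates the original end v + (a + b) on `s.1` because the
      -- loop effect is nonnegative there.
      have h1 : Sol T (s' :: S) (v + a.sum + (b ++ a).sum + b.sum) m := h.mono hS' fun j hj => by
        have := hnn j hj
        simp only [List.sum_append, Pi.add_apply] at this ⊢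
        linarith
      refine ⟨_, h1.prepend hTb (hsb.mono hS'.1 fun j hj => ?_)⟩
      have := hnn j (hS'.1 hj)
      rw [hcomm, Pi.add_apply _ (a ++ b).sum]
      linarith
  refine ⟨_, [], b ++ a, m', ?_, ?_, fun j => by rw [hcomm]; exact hJ j, hm', rfl⟩
  · intro t ht
    rw [List.nil_append] at ht
    exact (List.mem_append.mp ht).elim (hTb t) (hTa t)
  · rw [List.nil_append, safe_append]
    refine ⟨hsb, hsa.mono subset_rfl fun j hj => ?_⟩
    have := hnn j hj
    simp only [List.sum_append, Pi.add_apply] at this ⊢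
    linarith

/-- As long as no coordinate reaches `d * L`, each segment is replaced by two short walks, whence
the factor 2K. The first excess ends the process at the cost of one more walk and a solution of
length `L`. -/
lemma ShortSolutions.succ {Δ d K i L : ℕ} (hΔ1 : 1 ≤ Δ)
    (hΔ : ∀ t ∈ T, ∀ j, (t j).natAbs ≤ Δ) (hd1 : 1 ≤ d) (hd : ∀ t ∈ T, ∀ j, -(d : ℤ) ≤ t j)
    (hL1 : 1 ≤ L) (hL : ShortSolutions T R K i L) :
    ShortSolutions T R K (i + 1) (2 * K * (walkBound n Δ R ((d * L) ^ n) + 1) + L) := by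
  -- For the induction along the list, K is replaced in the bound by the number of remaining
  -- segments.
  suffices ∀ (S : List (Finset (Fin n) × (Fin n → Set ℤ))) (A : Finset (Fin n)) (v : Fin n → ℤ)
      (m : ℕ), WellFormed R A S → A.card ≤ i → S.length ≤ K → Sol T S v m →
      ∃ m' ≤ 2 * S.length * (walkBound n Δ R ((d * L) ^ n) + 1) + L, Sol T S v m' by
    intro S A v m hS hA hK h
    obtain ⟨m', hm', h'⟩ := this S A v m hS (by omega) hK h
    exact ⟨m', hm'.trans (by gcongr), h'⟩
  intro S
  induction S with
  | nil => intro A v m _ _ _ h; exact ⟨m, by rw [show m = 0 from h]; simp, h⟩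
  | cons s S ih =>
    intro A v m hS hA hK h
    have hS1 : WellFormed R s.1 (s :: S) := ⟨subset_rfl, hS.2⟩
    have hs1 : s.1.card ≤ i := (Finset.card_le_card hS.1).trans hA
    obtain ⟨-, hpos, htame, hrestWF⟩ := hS
    obtain ⟨p, q, m', hT, hs, hJ, hrest, rfl⟩ := h
    have hTp : ∀ t ∈ p, t ∈ T := fun t ht => hT t (List.mem_append_left _ ht)
    have hTq : ∀ t ∈ q, t ∈ T := fun t ht => hT t (List.mem_append_right _ ht)
    have hlen : 2 * (s :: S).length * (walkBound n Δ R ((d * L) ^ n) + 1) =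
        2 * S.length * (walkBound n Δ R ((d * L) ^ n) + 1) +
          2 * (walkBound n Δ R ((d * L) ^ n) + 1) := by
      rw [List.length_cons]; ring
    rcases below_or_exists_exceed (d * L) s.1 v (p ++ q) with hbd | ⟨p₁, p₂, hpp, hex, hbd⟩
    · rw [below_append] at hbd
      rw [safe_append] at hs
      have hb1 : 1 ≤ d * L := Nat.mul_pos hd1 hL1
      obtain ⟨r₁, hr₁T, hr₁, hr₁A, -, hr₁len⟩ := exists_short_safe (R := R) hΔ1 hΔ hb1 hTp hs.1
        hbd.1 (J := fun _ => Set.univ) (fun _ => tame_univ R) fun _ => trivial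
      obtain ⟨r₂, hr₂T, hr₂, hr₂A, hr₂J, hr₂len⟩ := exists_short_safe hΔ1 hΔ hb1 hTq hs.2
        hbd.2 htame hJ
      obtain ⟨m₀, hm₀, hsol⟩ := ih s.1 (v + (r₁ ++ r₂).sum) m' hrestWF hs1
        (by rw [List.length_cons] at hK; omega)
        (hrest.mono hrestWF fun j hj => by simp [hr₁A j hj, hr₂A j hj])
      refine ⟨r₁.length + r₂.length + m₀, by omega, r₁, r₂, m₀, ?_, ?_, hr₂J, hsol, rfl⟩
      · intro t ht
        exact (List.mem_append.mp ht).elim (hr₁T t) (hr₂T t)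
      · rw [safe_append]
        exact ⟨hr₁, hr₂.mono subset_rfl fun j hj => by simp [hr₁A j hj]⟩
    · have hT₁ : ∀ t ∈ p₁, t ∈ T := fun t ht => hT t (by rw [hpp]; exact List.mem_append_left _ ht)
      have hs₁ : Safe s.1 v p₁ := by rw [hpp, safe_append] at hs; exact hs.1
      have hsol : ∃ m₀, Sol T (s :: S) (v + p₁.sum) m₀ := by
        -- The excess lies either in the constrained part, which must be rotated, or in the free
        -- part, which can simply be cut.
        rcases List.append_eq_append_iff.mp hpp with ⟨a, rfl, rfl⟩ | ⟨a, rfl, rfl⟩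
        · rw [safe_append] at hs
          rw [List.sum_append, ← add_assoc] at hrest ⊢
          exact Sol.rotate hS1 hTq hs.2 hJ hrest
        · refine ⟨_, a, q, m', fun t ht => hT t ?_, ?_, hJ, ?_, rfl⟩
          · rw [List.append_assoc]; exact List.mem_append_right _ ht
          · rw [List.append_assoc, safe_append] at hs; exact hs.2
          · rw [List.append_assoc, List.sum_append, ← add_assoc] at hrest; exact hrest
      obtain ⟨m₀, hm₀⟩ := hsol
      obtain ⟨m₁, hm₁, h₁⟩ := Sol.exists_short_of_exceed hΔ1 hΔ hd1 hd hL1 hL hS1 hs1 hK hT₁ hs₁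
        hex hbd hm₀
      exact ⟨m₁, by omega, h₁⟩

end GenUnbound

/-! ### Arithmetic of the bound -/

namespace GenUnbound

/-- Every quantity is bounded by a power of `B`; since `B` is at least 4, sums and small constants
cost one more in the exponent. With a = n²e the exponent of (dL)^n, the total is at most 16n²a, and
16 ≤ n^4 turns this into e * n^8. -/
lemma walkBound_step_le {n Δ R K d L B e : ℕ} (hn : 2 ≤ n) (hB : 4 ≤ B) (hΔ : Δ ≤ B) (hR : R ≤ B)
    (hK : 2 * K ≤ B) (hd : d ≤ B) (hne : n ≤ e) (hL : L ≤ B ^ e) :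
    2 * K * (walkBound n Δ R ((d * L) ^ n) + 1) + L ≤ B ^ (e * n ^ 8) := by
  have mono : ∀ {a b : ℕ}, a ≤ b → B ^ a ≤ B ^ b := fun h => Nat.pow_le_pow_right (by omega) h
  have hn1 : n + 1 ≤ B ^ n := (Nat.lt_two_pow_self).trans_le (Nat.pow_le_pow_left (by omega) n)
  have four : ∀ k : ℕ, 4 * B ^ k ≤ B ^ (k + 1) := fun k => by
    rw [pow_succ']; exact Nat.mul_le_mul_right _ hB
  have hB1 : ∀ k : ℕ, 1 ≤ B ^ k := fun k => Nat.one_le_pow _ _ (by omega)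
  obtain ⟨N, hNdef⟩ : ∃ N, N = (d * L) ^ n := ⟨_, rfl⟩
  rw [← hNdef]
  obtain ⟨a, ha⟩ : ∃ a, a = n * (n * e) := ⟨_, rfl⟩
  have hne2 : e + 1 ≤ n * e := by nlinarith
  have hN : N ≤ B ^ a := by
    calc N ≤ (B ^ (n * e)) ^ n := by
          rw [hNdef]
          refine Nat.pow_le_pow_left ?_ n
          calc d * L ≤ B * B ^ e := Nat.mul_le_mul hd hL
            _ = B ^ (e + 1) := (pow_succ' _ _).symm
            _ ≤ _ := mono hne2
      _ = B ^ a := by rw [← pow_mul, mul_comm (n * e) n, ha]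
  have hD : N * Δ ≤ B ^ (a + 1) := by
    rw [pow_succ]; exact Nat.mul_le_mul hN hΔ
  have h1 : (2 * (N * Δ) + 1) ^ n ≤ B ^ (n * (a + 2)) := by
    rw [mul_comm n, pow_mul]
    refine Nat.pow_le_pow_left ?_ n
    have := hB1 (a + 1)
    have e3 : 4 * B ^ (a + 1) ≤ B ^ (a + 2) := four (a + 1)
    omega
  have h2 : ((n + 1) * (N * Δ)) ^ n ≤ B ^ (n * (n + a + 1)) := by
    rw [mul_comm n (n + a + 1), pow_mul]
    refine Nat.pow_le_pow_left ?_ n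
    rw [add_assoc, pow_add]
    exact Nat.mul_le_mul hn1 hD
  have h3 : (2 * (N * Δ) + 1) ^ n + n ≤ B ^ (n * (a + 2) + 1) := by
    have e1 := four (n * (a + 2))
    have e2 : B ^ n ≤ B ^ (n * (a + 2)) := mono (by nlinarith)
    omega
  obtain ⟨M, hM⟩ : ∃ M, M = n * (a + 2) + n * (n + a + 1) + a + 2 := ⟨_, rfl⟩
  have hea : e ≤ a := by
    rw [ha, ← mul_assoc]
    exact Nat.le_mul_of_pos_left e (Nat.mul_pos (by omega) (by omega))
  have hna : n ≤ a := hne.trans hea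
  have hna2 : 2 * (a + 2) ≤ n * (a + 2) := Nat.mul_le_mul_right _ hn
  have hM2 : 2 * a + 2 ≤ M := by omega
  have h4 : ((2 * (N * Δ) + 1) ^ n + n) * ((n + 1) * (N * Δ)) ^ n * (N * Δ) ≤ B ^ M := by
    calc _ ≤ B ^ (n * (a + 2) + 1) * B ^ (n * (n + a + 1)) * B ^ (a + 1) := by gcongr
      _ = B ^ M := by rw [← pow_add, ← pow_add, hM]; congr 1; ring
  have hNN : N * N + N ≤ 2 * B ^ (2 * a) := by
    have e1 : N * N ≤ B ^ (2 * a) := by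
      rw [two_mul, pow_add]; exact Nat.mul_le_mul hN hN
    have e2 : B ^ a ≤ B ^ (2 * a) := mono (by omega)
    omega
  have h5 : (N * N + N) * Δ ≤ B ^ M := by
    calc (N * N + N) * Δ ≤ (2 * B ^ (2 * a)) * B := Nat.mul_le_mul hNN hΔ
      _ ≤ B ^ (2 * a + 1) * B := by
        have := four (2 * a)
        exact Nat.mul_le_mul_right _ (by omega)
      _ = B ^ (2 * a + 2) := (pow_succ _ _).symm
      _ ≤ _ := mono hM2
  have h6 : loopBound n Δ R N ≤ B ^ (n * (n + M + 1)) := by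
    rw [loopBound, mul_comm n (n + M + 1), pow_mul]
    refine Nat.pow_le_pow_left ?_ n
    rw [add_assoc n, pow_add]
    refine Nat.mul_le_mul hn1 ?_
    have e1 := four M
    have e2 : R ≤ B ^ M := hR.trans (by
      calc B = B ^ 1 := (pow_one B).symm
        _ ≤ _ := mono (by omega))
    have e3 : N * Δ ≤ B ^ M := hD.trans (mono (by omega))
    omega
  obtain ⟨Y, hY⟩ : ∃ Y, Y = n * (a + 2) + n * (n + M + 1) + a := ⟨_, rfl⟩
  have h7 : walkBound n Δ R N + 1 ≤ B ^ (Y + 1) := by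
    have e1 : (2 * (N * Δ) + 1) ^ n * (loopBound n Δ R N * N) ≤ B ^ Y := by
      calc _ ≤ B ^ (n * (a + 2)) * (B ^ (n * (n + M + 1)) * B ^ a) := by gcongr
        _ = B ^ Y := by rw [← pow_add, ← pow_add, hY]; congr 1; ring
    have e2 : B ^ (2 * a) ≤ B ^ Y := mono (by omega)
    have e3 := four Y
    have e4 := hB1 Y
    rw [walkBound]
    have : (2 * (N * Δ) + 1) ^ n * (loopBound n Δ R N * N) + (N * N + N) + 1 ≤ 4 * B ^ Y := by
      omega
    omega
  have h8 : 2 * K * (walkBound n Δ R N + 1) + L ≤ B ^ (Y + 3) := by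
    have e1 : 2 * K * (walkBound n Δ R N + 1) ≤ B ^ (Y + 2) := by
      rw [pow_succ' B (Y + 1)]; exact Nat.mul_le_mul hK h7
    have e2 : B ^ e ≤ B ^ (Y + 2) := mono (by omega)
    have e3 : 4 * B ^ (Y + 2) ≤ B ^ (Y + 3) := four (Y + 2)
    omega
  refine h8.trans (mono ?_)
  have ha8 : 8 ≤ a := by
    rw [ha]
    calc 8 = 2 * (2 * 2) := rfl
      _ ≤ n * (n * e) := Nat.mul_le_mul hn (Nat.mul_le_mul hn (hn.trans hne))
  have g1 : n * a ≥ 2 * a := Nat.mul_le_mul_right a hn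
  have g2 : n * (n * a) ≥ 2 * (n * a) := Nat.mul_le_mul_right _ hn
  have g3 : n * (a + 2) ≤ n * (2 * a) := Nat.mul_le_mul_left n (by omega)
  have g4 : n * (n + a + 1) ≤ n * (3 * a) := Nat.mul_le_mul_left n (by omega)
  have g5 : n * (n + M + 1) ≤ n * (7 * (n * a)) := Nat.mul_le_mul_left n (by
    have : n * (2 * a) = 2 * (n * a) := by ring
    have : n * (3 * a) = 3 * (n * a) := by ring
    omega)
  have g6 : Y + 3 ≤ 16 * (n * (n * a)) := by
    have : n * (2 * a) = 2 * (n * a) := by ring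
    have : n * (7 * (n * a)) = 7 * (n * (n * a)) := by ring
    omega
  have g7 : 16 ≤ n ^ 4 := Nat.pow_le_pow_left hn 4
  calc Y + 3 ≤ 16 * (n * (n * a)) := g6
    _ ≤ n ^ 4 * (n * (n * a)) := Nat.mul_le_mul_right _ g7
    _ = e * n ^ 8 := by rw [ha]; ring

variable {n : ℕ} {T : Finset (Fin n → ℤ)}

/-- Solvable lists of segments have doubly exponentially bounded solutions. -/
lemma shortSolutions {Δ R K d B : ℕ} (hn : 2 ≤ n) (hB : 4 ≤ B) (hΔB : Δ ≤ B) (hR : R ≤ B)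
    (hK : 2 * K ≤ B) (hdB : d ≤ B) (hΔ1 : 1 ≤ Δ) (hΔ : ∀ t ∈ T, ∀ j, (t j).natAbs ≤ Δ)
    (hd1 : 1 ≤ d) (hd : ∀ t ∈ T, ∀ j, -(d : ℤ) ≤ t j) (i : ℕ) :
    ShortSolutions T R K i (B ^ n ^ (1 + 8 * i)) := by
  induction i with
  -- Vacuous, as no set has negative cardinality. The summand 1 in the exponent 1 + 8i only serves
  -- to keep n ≤ e in `walkBound_step_le`.
  | zero => intro S A v m _ hA; omega
  | succ i ih =>
    intro S A v m hS hA hSK h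
    obtain ⟨m', hm', h'⟩ := ih.succ hΔ1 hΔ hd1 hd (Nat.one_le_pow _ _ (by omega)) S A v m hS hA hSK h
    refine ⟨m', hm'.trans ?_, h'⟩
    have := walkBound_step_le (e := n ^ (1 + 8 * i)) hn hB hΔB hR hK hdB
      (Nat.le_self_pow (by omega) n) le_rfl
    refine this.trans (le_of_eq ?_)
    rw [← pow_add]
    congr 2

/-- The sign is fixed because (P2) and (P3) depend only on the signs of effects. An element is
either bounded by `R`, and taken as a constant progression, or lies on a ray of constant sign inside
the interval, starting at its endpoint or at ±1. -/
lemma tame_interval (I : Interval) {R : ℕ} (hI : I.absMax ≤ R) (hR : 1 ≤ R) (s : ℤ) :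
    Tame R {x | x ∈ I.toSet ∧ x.sign = s} := by
  rintro e ⟨heI, rfl⟩
  have const : e.natAbs ≤ R → ∃ a σ : ℤ, a.natAbs ≤ R ∧ σ.natAbs ≤ 1 ∧ (∃ s : ℕ, e = a + σ * s) ∧
      ∀ s : ℕ, a + σ * s ∈ {x | x ∈ I.toSet ∧ x.sign = e.sign} := fun h =>
    ⟨e, 0, h, by simp, ⟨0, by simp⟩, fun s => by simpa using heI⟩
  have up : ∀ a : ℤ, a.natAbs ≤ R → 1 ≤ a → a ≤ e → (∀ x, a ≤ x → x ∈ I.toSet) →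
      ∃ a σ : ℤ, a.natAbs ≤ R ∧ σ.natAbs ≤ 1 ∧ (∃ s : ℕ, e = a + σ * s) ∧
      ∀ s : ℕ, a + σ * s ∈ {x | x ∈ I.toSet ∧ x.sign = e.sign} := fun a h1 h2 h3 h4 =>
    ⟨a, 1, h1, by simp, ⟨(e - a).toNat, by omega⟩, fun s => ⟨h4 _ (by omega), by
      rw [Int.sign_eq_one_of_pos (by omega), Int.sign_eq_one_of_pos (by omega)]⟩⟩
  have down : ∀ a : ℤ, a.natAbs ≤ R → a ≤ -1 → e ≤ a → (∀ x, x ≤ a → x ∈ I.toSet) →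
      ∃ a σ : ℤ, a.natAbs ≤ R ∧ σ.natAbs ≤ 1 ∧ (∃ s : ℕ, e = a + σ * s) ∧
      ∀ s : ℕ, a + σ * s ∈ {x | x ∈ I.toSet ∧ x.sign = e.sign} := fun a h1 h2 h3 h4 =>
    ⟨a, -1, h1, by simp, ⟨(a - e).toNat, by omega⟩, fun s => ⟨h4 _ (by omega), by
      rw [Int.sign_eq_neg_one_of_neg (by omega), Int.sign_eq_neg_one_of_neg (by omega)]⟩⟩
  cases I with
  | all =>
    rcases lt_trichotomy e 0 with h | h | h
    · exact down (-1) (by omega) le_rfl (by omega) fun _ _ => trivial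
    · exact const (by omega)
    · exact up 1 (by omega) le_rfl (by omega) fun _ _ => trivial
  | ge a =>
    simp only [Interval.toSet, Set.mem_Ici, Interval.absMax] at heI hI up
    rcases le_or_gt e 0 with h | h
    · exact const (by omega)
    · exact up (max a 1) (by omega) (by omega) (by omega) fun _ _ => by omega
  | le b =>
    simp only [Interval.toSet, Set.mem_Iic, Interval.absMax] at heI hI down
    rcases lt_or_ge e 0 with h | h
    · exact down (min b (-1)) (by omega) (by omega) (by omega) fun _ _ => by omega
    · exact const (by omega)
  | between a b =>
    simp only [Interval.toSet, Set.mem_Icc, Interval.absMax] at heI hI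
    refine const ?_
    clear const up down
    omega

/-! ### From pseudo-runs to lists of segments and back -/

namespace PseudoRun

lemma config_eq_add_slice (ρ : PseudoRun T) {a b : ℕ} (hab : a ≤ b) :
    ρ.config b = ρ.config a + ((ρ.path.drop a).take (b - a)).sum := by
  rw [config, config, add_assoc, ← List.sum_append, ← List.take_add]
  congr 3
  omega

lemma exists_config_of_mem_trace (ρ : PseudoRun T) {a b : ℕ} {x : Fin n → ℤ}
    (hx : x ∈ trace (AddMonoidHom.id _) (ρ.config a) ((ρ.path.drop a).take (b - a))) :
    ∃ i, a ≤ i ∧ i ≤ a + (b - a) ∧ x = ρ.config i := by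
  obtain ⟨p₁, p₂, h, rfl⟩ := mem_trace_id.mp hx
  have hlen : p₁.length ≤ b - a := by
    have := congrArg List.length h
    simp only [List.length_take, List.length_append] at this
    omega
  refine ⟨a + p₁.length, by omega, by omega, ?_⟩
  rw [ρ.config_eq_add_slice (Nat.le_add_right a p₁.length), Nat.add_sub_cancel_left]
  have : p₁ = (ρ.path.drop a).take p₁.length := by
    have h2 := congrArg (List.take p₁.length) h
    rw [List.take_take, min_eq_left hlen, List.take_left] at h2
    exact h2.symm
  rw [← this]

/-- A decomposed run solves a list of segments describing its parts. -/
lemma sol_of_decomposition (ρ : PseudoRun T) (f : ℕ → ℕ) (K : ℕ)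
    (hmono : ∀ i < 2 * K, f i ≤ f (i + 1))
    (g : ℕ → Finset (Fin n) × (Fin n → Set ℤ))
    (hsafe : ∀ l < K, ∀ i, f (2 * l) ≤ i → i ≤ f (2 * l + 2) → ∀ j ∈ (g l).1, 0 ≤ ρ.config i j)
    (heff : ∀ l < K, ∀ j, ρ.effect f l j ∈ (g l).2 j) (k l : ℕ) (hkl : l + k = K) :
    ∃ m, Sol T ((List.range' l k).map g) (ρ.config (f (2 * l))) m := by
  induction k generalizing l with
  | zero => exact ⟨0, rfl⟩
  | succ k ih =>
    obtain ⟨m, hm⟩ := ih (l + 1) (by omega)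
    have h1 := hmono (2 * l) (by omega)
    have h2 : f (2 * l + 1) ≤ f (2 * l + 2) := hmono (2 * l + 1) (by omega)
    have c1 := ρ.config_eq_add_slice h1
    have c2 := ρ.config_eq_add_slice h2
    rw [List.range'_succ, List.map_cons]
    refine ⟨_, (ρ.path.drop (f (2 * l))).take (f (2 * l + 1) - f (2 * l)),
      (ρ.path.drop (f (2 * l + 1))).take (f (2 * l + 2) - f (2 * l + 1)), m, ?_, ?_, ?_, ?_, rfl⟩
    · intro t ht
      refine ρ.path_mem t ?_
      rcases List.mem_append.mp ht with ht | ht <;>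
        exact List.mem_of_mem_drop (List.mem_of_mem_take ht)
    · rw [safe_append, ← c1]
      constructor
      · intro x hx j hj
        obtain ⟨i, hi1, hi2, rfl⟩ := ρ.exists_config_of_mem_trace hx
        exact hsafe l (by omega) i hi1 (by omega) j hj
      · intro x hx j hj
        obtain ⟨i, hi1, hi2, rfl⟩ := ρ.exists_config_of_mem_trace hx
        exact hsafe l (by omega) i (by omega) (by omega) j hj
    · intro j
      have := heff l (by omega) j
      rw [effect] at this
      rwa [c2, add_sub_cancel_left] at this
    · rw [List.sum_append, ← add_assoc, ← c1, ← c2]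
      exact hm

end PseudoRun

/-- A solution of a list of segments yields a path with a decomposition. -/
lemma Sol.exists_decomposition {S : List (Finset (Fin n) × (Fin n → Set ℤ))} {v : Fin n → ℤ}
    {m : ℕ} (h : Sol T S v m) :
    ∃ (ρ : PseudoRun T) (f : ℕ → ℕ), ρ.start = v ∧ ρ.path.length = m ∧
      ρ.IsDecomposition S.length f ∧
      ∀ (l : ℕ) (hl : l < S.length), (∀ j, ρ.effect f l j ∈ S[l].2 j) ∧
        ∀ i, f (2 * l) ≤ i → i ≤ f (2 * l + 2) → ∀ j ∈ S[l].1, 0 ≤ ρ.config i j := by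
  induction S generalizing v m with
  | nil =>
    exact ⟨⟨v, [], by simp⟩, fun _ => 0, rfl, (show m = 0 from h).symm, ⟨rfl, rfl, by simp⟩,
      fun l hl => absurd hl (by simp)⟩
  | cons s S ih =>
    obtain ⟨p, q, m', hT, hs, hJ, hrest, rfl⟩ := h
    obtain ⟨ρ, f, hstart, hlen, ⟨hf0, hfK, hfm⟩, hρ⟩ := ih hrest
    let ρ' : PseudoRun T := ⟨v, (p ++ q) ++ ρ.path, fun t ht =>
      (List.mem_append.mp ht).elim (hT t) (ρ.path_mem t)⟩
    -- The new segment contributes the cut points 0 and |p|; the old ones move by two indices and by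
    -- |p| + |q| positions.
    let f' : ℕ → ℕ
      | 0 => 0
      | 1 => p.length
      | k + 2 => (p ++ q).length + f k
    have hcfg : ∀ i, ρ'.config ((p ++ q).length + i) = ρ.config i := by
      intro i
      simp only [ρ', PseudoRun.config]
      rw [List.take_length_add_append, List.sum_append, ← add_assoc, hstart]
    have hcfg0 : ∀ i ≤ (p ++ q).length, ρ'.config i = v + ((p ++ q).take i).sum := by
      intro i hi
      simp only [ρ', PseudoRun.config]
      rw [List.take_append_of_le_length hi]
    refine ⟨ρ', f', rfl, ?_, ⟨rfl, ?_, ?_⟩, ?_⟩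
    · simp [ρ', hlen, add_assoc]
    · show (p ++ q).length + f (2 * S.length) = _
      rw [hfK]
      simp [ρ', add_assoc]
    · rintro (_ | _ | i) hi
      · exact Nat.zero_le _
      · show p.length ≤ (p ++ q).length + f 0
        simp [add_assoc]
      · have := hfm i (by rw [List.length_cons] at hi; omega)
        show (p ++ q).length + f i ≤ (p ++ q).length + f (i + 1)
        omega
    · rintro (_ | l) hl
      · constructor
        · intro j
          have e : ρ'.effect f' 0 = q.sum := by
            rw [PseudoRun.effect]
            show ρ'.config ((p ++ q).length + f 0) - ρ'.config p.length = _
            rw [hf0, add_zero, hcfg0 _ le_rfl, hcfg0 _ (by simp), List.take_length, List.take_left,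
              List.sum_append]
            abel
          rw [e]
          exact hJ j
        · intro i _ hi j hj
          have hi' : i ≤ (p ++ q).length := by
            have : i ≤ (p ++ q).length + f 0 := hi
            rwa [hf0] at this
          rw [hcfg0 i hi']
          exact hs _ (mem_trace_id.mpr ⟨_, _, (List.take_append_drop i _).symm, rfl⟩) j hj
      · obtain ⟨h1, h2⟩ := hρ l (by simpa using hl)
        constructor
        · intro j
          have e : ρ'.effect f' (l + 1) = ρ.effect f l := by
            rw [PseudoRun.effect, PseudoRun.effect, ← hcfg, ← hcfg]
            rfl
          rw [e]
          exact h1 j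
        · intro i hi1 hi2 j hj
          have hi1' : (p ++ q).length + f (2 * l) ≤ i := hi1
          have hi2' : i ≤ (p ++ q).length + f (2 * l + 2) := hi2
          obtain ⟨i', rfl⟩ := Nat.exists_eq_add_of_le (show (p ++ q).length ≤ i by omega)
          rw [hcfg]
          exact h2 i' (by omega) (by omega) j hj

lemma wellFormed_map_range' {g : ℕ → Finset (Fin n) × (Fin n → Set ℤ)} {R K : ℕ}
    (hanti : ∀ l, (g (l + 1)).1 ⊆ (g l).1)
    (hpos : ∀ l < K, ∀ j ∈ (g l).1, ∀ e ∈ (g l).2 j, 0 ≤ e)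
    (htame : ∀ l < K, ∀ j, Tame R ((g l).2 j)) (k l : ℕ) (hkl : l + k = K)
    {A : Finset (Fin n)} (hA : (g l).1 ⊆ A) : WellFormed R A ((List.range' l k).map g) := by
  induction k generalizing l A with
  | zero => trivial
  | succ k ih =>
    rw [List.range'_succ, List.map_cons]
    exact ⟨hA, hpos l (by omega), htame l (by omega), ih (l + 1) (by omega) (hanti l)⟩

lemma isDecomposition_mono {ρ : PseudoRun T} {K : ℕ} {f : ℕ → ℕ} (h : ρ.IsDecomposition K f)
    {a b : ℕ} (hab : a ≤ b) (hb : b ≤ 2 * K) : f a ≤ f b := by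
  induction b, hab using Nat.le_induction with
  | base => exact le_rfl
  | succ b _ ih => exact (ih (by omega)).trans (h.2.2 b (by omega))

/-- The small pseudo-run property for weak satisfaction. -/
lemma PseudoRun.WeaklySatisfies.exists_short {K : ℕ} (hK : 1 ≤ K) {P : Property n K}
    {ρ : PseudoRun T} (h : ρ.WeaklySatisfies P) {R L : ℕ} (hR1 : 1 ≤ R)
    (hP : ∀ l j, (P l j).absMax ≤ R) (hL : ShortSolutions T R K (n + 1) L) :
    ∃ ρ' : PseudoRun T, ρ'.start = ρ.start ∧ ρ'.WeaklySatisfies P ∧ ρ'.length ≤ L + 1 := by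
  classical
  obtain ⟨f, hf, hP1, hP2, hP3⟩ := h
  -- The value beyond K is a filler, since only indices below K enter the list.
  let I : ℕ → Fin n → Interval := fun l j => if h : l < K then P ⟨l, h⟩ j else Interval.all
  -- Segment l requires nonnegativity on the coordinates that no earlier constrained part increases,
  -- and an effect in the prescribed interval with the sign it has in `ρ`.
  let g : ℕ → Finset (Fin n) × (Fin n → Set ℤ) := fun l =>
    (Finset.univ.filter fun j => ∀ l' < l, l' < K → ρ.effect f l' j ≤ 0,
      fun j => {x | x ∈ (I l j).toSet ∧ x.sign = (ρ.effect f l j).sign})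
  have hI : ∀ (l : Fin K) j, I l j = P l j := fun l j => by simp [I]
  have hsafe : ∀ l < K, ∀ i, f (2 * l) ≤ i → i ≤ f (2 * l + 2) → ∀ j ∈ (g l).1,
      0 ≤ ρ.config i j := by
    intro l hl i _ hi j hj
    have hj' : ∀ l' < l, l' < K → ρ.effect f l' j ≤ 0 := by simpa [g] using hj
    by_contra hneg
    push Not at hneg
    have hik : i ≤ ρ.path.length := by
      rw [← hf.2.1]
      exact hi.trans (isDecomposition_mono hf (by omega) le_rfl)
    obtain ⟨l₀, h1, h2⟩ := hP3 j i hik hneg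
    by_cases hlt : (l₀ : ℕ) < l
    · exact absurd h2 (not_lt.mpr (hj' l₀ hlt l₀.2))
    · have := isDecomposition_mono hf (a := 2 * l + 2) (b := 2 * l₀ + 2) (by omega) (by omega)
      omega
  have heff : ∀ l < K, ∀ j, ρ.effect f l j ∈ (g l).2 j := by
    intro l hl j
    refine ⟨?_, rfl⟩
    have := hP1 ⟨l, hl⟩ j
    rwa [← hI ⟨l, hl⟩ j] at this
  obtain ⟨m, hm⟩ := ρ.sol_of_decomposition f K hf.2.2 g hsafe heff K 0 (by omega)
  have hWF : WellFormed R (g 0).1 ((List.range' 0 K).map g) := by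
    refine wellFormed_map_range' (K := K) ?_ ?_ ?_ K 0 (by omega) subset_rfl
    · intro l j hj
      simp only [g, Finset.mem_filter, Finset.mem_univ, true_and] at hj ⊢
      exact fun l' hl' => hj l' (by omega)
    · rintro l hl j hj e ⟨-, he⟩
      have hj' : ∀ l' < l, l' < K → ρ.effect f l' j ≤ 0 := by simpa [g] using hj
      have : 0 ≤ ρ.effect f l j := by
        by_contra hneg
        push Not at hneg
        obtain ⟨l', h1, h2⟩ := hP2 ⟨l, hl⟩ j hneg
        exact absurd h2 (not_lt.mpr (hj' l' h1 l'.2))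
      rw [← Int.sign_nonneg_iff] at this ⊢
      rwa [he]
    · intro l hl j
      exact tame_interval _ (by rw [hI ⟨l, hl⟩ j]; exact hP _ _) hR1 _
  obtain ⟨m', hm', hsol⟩ := hL _ _ _ m hWF
    (Nat.lt_succ_of_le (by simpa using Finset.card_le_univ (g 0).1)) (by simp) hm
  obtain ⟨ρ', f', hstart, hlen, hf', hρ'⟩ := hsol.exists_decomposition
  simp only [List.length_map, List.length_range', List.getElem_map, List.getElem_range', zero_add,
    one_mul] at hf' hρ'
  have hsign : ∀ (l : Fin K) j, (ρ'.effect f' l j).sign = (ρ.effect f l j).sign := fun l j =>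
    ((hρ' l l.2).1 j).2
  refine ⟨ρ', ?_, ⟨f', hf', ?_, ?_, ?_⟩, ?_⟩
  · rw [hstart, mul_zero, hf.1]
    simp [PseudoRun.config]
  · intro l j
    have := ((hρ' l l.2).1 j).1
    rwa [hI] at this
  · intro l j hneg
    rw [← Int.sign_eq_neg_one_iff_neg, hsign, Int.sign_eq_neg_one_iff_neg] at hneg
    obtain ⟨l', h1, h2⟩ := hP2 l j hneg
    refine ⟨l', h1, ?_⟩
    rwa [← Int.sign_eq_one_iff_pos, hsign, Int.sign_eq_one_iff_pos]
  · intro j i hi hneg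
    by_contra hno
    push Not at hno
    -- Take the first segment l ending at or after i. All earlier ones end strictly before i, so if
    -- (P3) failed none of them would increase j; then j is among the coordinates kept nonnegative
    -- on segment l, a contradiction.
    have hex : ∃ l, i ≤ f' (2 * l + 2) := ⟨K - 1, by
      rw [show 2 * (K - 1) + 2 = 2 * K by omega, hf'.2.1]; exact hi⟩
    let l := Nat.find hex
    have hl : i ≤ f' (2 * l + 2) := Nat.find_spec hex
    have hlK : l < K := by
      have : l ≤ K - 1 := Nat.find_min' hex (by
        rw [show 2 * (K - 1) + 2 = 2 * K by omega, hf'.2.1]; exact hi)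
      omega
    have hmin : ∀ l' < l, f' (2 * l' + 2) < i := fun l' hl' => not_le.mp (Nat.find_min hex hl')
    have hfl : f' (2 * l) ≤ i := by
      rcases Nat.eq_zero_or_pos l with h0 | h0
      · rw [h0, mul_zero, hf'.1]; exact Nat.zero_le i
      · have := hmin (l - 1) (by omega)
        rw [show 2 * (l - 1) + 2 = 2 * l by omega] at this
        exact this.le
    refine absurd ((hρ' l hlK).2 i hfl hl j ?_) (not_le.mpr hneg)
    simp only [g, Finset.mem_filter, Finset.mem_univ, true_and]
    intro l' hl' hl'K
    have := hno ⟨l', hl'K⟩ (hmin l' hl')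
    rw [← not_lt, ← Int.sign_eq_one_iff_pos] at this ⊢
    rwa [← hsign ⟨l', hl'K⟩ j]
  · rw [PseudoRun.length, hlen]
    omega

end GenUnbound

/-! ### The constant -/

theorem mainTheorem4 :
    ∃ C : ℕ, 1 < C ∧
      ∀ (n : ℕ), 2 ≤ n →
      ∀ (T : Finset (Fin n → ℤ)), 1 ≤ GenUnbound.negNorm T →
      ∀ (K : ℕ), 1 ≤ K →
      ∀ (P : GenUnbound.Property n K) (ρ : GenUnbound.PseudoRun T), ρ.WeaklySatisfies P →
      ∃ ρ' : GenUnbound.PseudoRun T, ρ'.start = ρ.start ∧ ρ'.WeaklySatisfies P ∧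
        ρ'.length ≤
          (2 * ((1 + K) * GenUnbound.absNorm T * P.scale) * GenUnbound.negNorm T) ^
            (n ^ ((2 * n + 1) * C)) := by
  -- The induction yields the exponent n^(1 + 8(n+1)). One further factor n absorbs the difference
  -- between counting vectors and transitions, and 8n + 10 ≤ 8(2n + 1).
  refine ⟨8, by norm_num, fun n hn T hT K hK P ρ hρ => ?_⟩
  have hΔ : ∀ t ∈ T, ∀ j, (t j).natAbs ≤ GenUnbound.absNorm T := fun t ht j =>
    (Finset.le_sup (f := fun i => (t i).natAbs) (Finset.mem_univ j)).trans
      (Finset.le_sup (f := fun b : Fin n → ℤ => Finset.univ.sup fun i => (b i).natAbs) ht)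
  have hd : ∀ t ∈ T, ∀ j, -(GenUnbound.negNorm T : ℤ) ≤ t j := fun t ht j => by
    have : (-(t j)).toNat ≤ GenUnbound.negNorm T :=
      (Finset.le_sup (f := fun i => (-(t i)).toNat) (Finset.mem_univ j)).trans
        (Finset.le_sup (f := fun b : Fin n → ℤ => Finset.univ.sup fun i => (-(b i)).toNat) ht)
    omega
  have hΔ1 : 1 ≤ GenUnbound.absNorm T := hT.trans <| Finset.sup_mono_fun fun t _ =>
    Finset.sup_mono_fun fun j _ => by omega
  have hR1 : 1 ≤ P.scale := le_max_left _ _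
  have hP : ∀ l j, (P l j).absMax ≤ P.scale := fun l j =>
    ((Finset.le_sup (f := fun j => (P l j).absMax) (Finset.mem_univ j)).trans
      (Finset.le_sup (f := fun l => Finset.univ.sup fun j => (P l j).absMax)
        (Finset.mem_univ l))).trans (le_max_right _ _)
  generalize GenUnbound.absNorm T = Δ at *
  generalize P.scale = R at *
  generalize GenUnbound.negNorm T = d at *
  set B := 2 * ((1 + K) * Δ * R) * d with hB
  have hprod : ∀ a b c e : ℕ, 1 ≤ b → 1 ≤ c → 1 ≤ e → a ≤ a * (b * (c * e)) :=
    fun a b c e hb hc he => Nat.le_mul_of_pos_right a (Nat.mul_pos hb (Nat.mul_pos hc he))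
  -- The base `B` dominates each of its factors, so all parameters of `shortSolutions` are at most
  -- `B`; K ≥ 1 gives B ≥ 4.
  have hBK : 2 * (1 + K) ≤ B :=
    (hprod (2 * (1 + K)) Δ R d hΔ1 hR1 hT).trans (le_of_eq (by rw [hB]; ring))
  have hBΔ : Δ ≤ B :=
    (hprod Δ (2 * (1 + K)) R d (by omega) hR1 hT).trans (le_of_eq (by rw [hB]; ring))
  have hBR : R ≤ B :=
    (hprod R (2 * (1 + K)) Δ d (by omega) hΔ1 hT).trans (le_of_eq (by rw [hB]; ring))
  have hBd : d ≤ B :=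
    (hprod d (2 * (1 + K)) Δ R (by omega) hΔ1 hR1).trans (le_of_eq (by rw [hB]; ring))
  have hB4 : 4 ≤ B := by omega
  obtain ⟨ρ', h1, h2, h3⟩ := hρ.exists_short hK hR1 hP
    (GenUnbound.shortSolutions hn hB4 hBΔ hBR (by omega) hBd hΔ1 hΔ hT hd (n + 1))
  refine ⟨ρ', h1, h2, h3.trans ?_⟩
  set E := n ^ (1 + 8 * (n + 1)) with hE
  have hpow : B ^ E + 1 ≤ B ^ (E + 1) := by
    have : 1 ≤ B ^ E := Nat.one_le_pow _ _ (by omega)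
    rw [pow_succ]
    nlinarith
  refine hpow.trans (Nat.pow_le_pow_right (by omega) ?_)
  have hE1 : 1 ≤ E := Nat.one_le_pow _ _ (by omega)
  calc E + 1 ≤ E * n := by nlinarith
    _ = n ^ (1 + 8 * (n + 1) + 1) := (pow_succ _ _).symm
    _ ≤ _ := Nat.pow_le_pow_right (by omega) (by omega)
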